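/- Let $\alpha,\omega,a,b,d_1,d_2$ be real with $\omega>0$ and $\beta:=-\tfrac{16}{3}\alpha\omega<1$. Let $$R_0(z)^2=\frac{4\omega}{1+\sqrt{1-\beta}\,\cosh(2\sqrt{\omega}\,z)},\quad R_0>0,\qquad \Lambda_m=\int_{-\infty}^{\infty}R_0(z)^m\,dz,\qquad \Lambda_{24}=\frac{\Lambda_2}{\Lambda_4},\qquad \Lambda_{d_2}=-\frac{8\omega}{\beta}\Big(\omega\Lambda_{24}-\frac34\Big)$$ (for $\beta=0$, where this formula is undefined, $\Lambda_{d_2}$ is $\Lambda_6/\Lambda_4$, which equals the formula for $\beta\neq0$). The symbol $\partial_\omega$ denotes the derivative in $\omega$ with all other parameters fixed. Put $$d_1^*=\frac a4-\Lambda_{24}\,b-\Lambda_{d_2}\Big(d_2-\frac{\alpha a}{3}\Big),\qquad b^*=-\frac{\partial_\omega\Lambda_{d_2}}{\partial_\omega\Lambda_{24}}\Big(d_2-\frac{\alpha a}{3}\Big).$$ For $\varepsilon>0$, $c\in\mathbb R$ and $\Delta=1+\varepsilon^2a^2$ consider the system $$\begin{aligned} r'&=rs,\\ \Delta s'&=-\Delta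 s^2+\Delta\phi^2-c(\varepsilon as-\phi)-(-\omega+\varepsilon^2ab)-(1+\varepsilon^2ad_1)r^2-(\alpha+\varepsilon^2ad_2)r^4,\\ \Delta\phi'&=-2\Delta s\phi-c(s+\varepsilon a\phi)-\varepsilon\big[(b+a\omega)+(d_1-a)r^2+(d_2-a\alpha)r^4\big].\end{aligned}$$ Take $c=0$, and let $(r^u,s^u,\phi^u)(z)$, $z\le0$, be the solution on the part $r>0$ of the unstable manifold of the equilibrium $(0,s_p,\phi_p)$ with $s_p>0$ (that is, the solution tends to this equilibrium as $z\to-\infty$ and has $r^u>0$), with phase fixed so that $s^u(z)>0$ for $z<0$ and $s^u(0)=0$. Then: 1. $\Lambda_{24}$ and $\Lambda_{d_2}$ are differentiable in $\omega$, and $\partial_\omega\Lambda_{24}\ne0$ (so $b^*$ is defined). 2. Suppose that $d_1$ equals $d_1^*$ up to $O(\varepsilon)$: let $C\ge0$ be a constant and $|d_1-d_1^*|\le C\varepsilon$, where $d_1^*$ is evaluated at the given $\omega$ and $d_1$ is held fixed when differentiating in $\omega$; in particular $d_1=d_1^*$ is allowed. Then there is $\varepsilon_0>0$, depending only on $\alpha,\omega,a,b,d_2,C$,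 such that for all $0<\varepsilon<\varepsilon_0$ and all such $d_1$ the value $\phi^u(0)$ exists and is unique for all frequencies in a neighbourhood of $\omega$, is differentiable in the frequency at $\omega$, and satisfies $$\partial_\omega\phi^u(0)>0\ \text{ if } b>b^*,\qquad \partial_\omega\phi^u(0)<0\ \text{ if } b<b^*.$$ 3. If $0\le\beta<1$, then $\dfrac{\partial_\omega\Lambda_{d_2}}{\partial_\omega\Lambda_{24}}<0$. -/

import Mathlib

open Filter Topology

namespace BrightWave

noncomputable section

/-- `β = -(16/3) α ω`. -/
def beta (α ω : ℝ) : ℝ := -(16 / 3) * α * ω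

/-- The amplitude `R₀` of the unperturbed bright solitary wave:
`R₀² = 4ω / (1 + √(1-β) cosh (2 √ω z))`. -/
def R0 (α ω z : ℝ) : ℝ :=
  √(4 * ω / (1 + √(1 - beta α ω) * Real.cosh (2 * √ω * z)))

/-- `Λ_m = ∫ R₀^m`. -/
def Lam (m : ℕ) (α ω : ℝ) : ℝ := ∫ z : ℝ, R0 α ω z ^ m

/-- `Λ₂₄ = Λ₂ / Λ₄`. -/
def Lam24 (α ω : ℝ) : ℝ := Lam 2 α ω / Lam 4 α ω

/-- `Λ_{d₂} = -(8ω/β) (ω Λ₂₄ - 3/4)`. For `β ≠ 0` this is `Λ₆ / Λ₄`, which is also the value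
taken at `β = 0`, where the formula is undefined. -/
def Lamd2 (α ω : ℝ) : ℝ :=
  if beta α ω = 0 then Lam 6 α ω / Lam 4 α ω
  else -(8 * ω / beta α ω) * (ω * Lam24 α ω - 3 / 4)

/-- `∂_ω Λ₂₄`, with `α` held fixed. -/
def dLam24 (α ω : ℝ) : ℝ := deriv (fun w => Lam24 α w) ω

/-- `∂_ω Λ_{d₂}`, with `α` held fixed. -/
def dLamd2 (α ω : ℝ) : ℝ := deriv (fun w => Lamd2 α w) ω

/-- `d₁* = a/4 - Λ₂₄ b - Λ_{d₂} (d₂ - α a / 3)`. -/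
def d1Star (α ω a b d₂ : ℝ) : ℝ :=
  a / 4 - Lam24 α ω * b - Lamd2 α ω * (d₂ - α * a / 3)

/-- `b* = -(∂_ω Λ_{d₂} / ∂_ω Λ₂₄) (d₂ - α a / 3)`. -/
def bStar (α ω a d₂ : ℝ) : ℝ :=
  -(dLamd2 α ω / dLam24 α ω) * (d₂ - α * a / 3)

/-- `Δ = 1 + ε² a²`. -/
def Del (a ε : ℝ) : ℝ := 1 + ε ^ 2 * a ^ 2

/-- The right-hand side of the equation for `s'` in the steady-state system (divided by `Δ`). -/
def sField (α a b d₁ d₂ ε c ω r s φ : ℝ) : ℝ :=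
  (-Del a ε * s ^ 2 + Del a ε * φ ^ 2 - c * (ε * a * s - φ) - (-ω + ε ^ 2 * a * b)
    - (1 + ε ^ 2 * a * d₁) * r ^ 2 - (α + ε ^ 2 * a * d₂) * r ^ 4) / Del a ε

/-- The right-hand side of the equation for `φ'` in the steady-state system (divided by `Δ`). -/
def phiField (α a b d₁ d₂ ε c ω r s φ : ℝ) : ℝ :=
  (-2 * Del a ε * s * φ - c * (s + ε * a * φ)
    - ε * ((b + a * ω) + (d₁ - a) * r ^ 2 + (d₂ - a * α) * r ^ 4)) / Del a ε

/-- `(r, s, φ)`, restricted to `z ≤ 0`, is the part `r > 0` of the unstable manifold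
`W^u_p(z, c, ω)` of the equilibrium `p = (0, s_p, φ_p)`, `s_p > 0`, of the steady-state system:
a solution with `r > 0` that tends to `p` as `z → -∞`. The phase is fixed by letting `z = 0`
be the first point where `s` vanishes (the crest of `r`, since `r' = r s`). -/
structure IsUnstableSolution (α a b d₁ d₂ ε c ω : ℝ) (r s φ : ℝ → ℝ) : Prop where
  deriv_r : ∀ z ≤ 0, HasDerivWithinAt r (r z * s z) (Set.Iic 0) z
  deriv_s : ∀ z ≤ 0,
    HasDerivWithinAt s (sField α a b d₁ d₂ ε c ω (r z) (s z) (φ z)) (Set.Iic 0) z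
  deriv_phi : ∀ z ≤ 0,
    HasDerivWithinAt φ (phiField α a b d₁ d₂ ε c ω (r z) (s z) (φ z)) (Set.Iic 0) z
  r_pos : ∀ z ≤ 0, 0 < r z
  tendsto_p : ∃ sp φp : ℝ, 0 < sp ∧
    sField α a b d₁ d₂ ε c ω 0 sp φp = 0 ∧ phiField α a b d₁ d₂ ε c ω 0 sp φp = 0 ∧
    Tendsto r atBot (𝓝 0) ∧ Tendsto s atBot (𝓝 sp) ∧ Tendsto φ atBot (𝓝 φp)
  s_pos : ∀ z < 0, 0 < s z
  s_zero : s 0 = 0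

/-- `x` is the value `φ^u(0)` of the `φ`-component of the unstable manifold at `z = 0`. -/
def IsPhiU (α a b d₁ d₂ ε c ω x : ℝ) : Prop :=
  ∃ r s φ : ℝ → ℝ, IsUnstableSolution α a b d₁ d₂ ε c ω r s φ ∧ φ 0 = x

end

end BrightWave

open BrightWave

/-!
For `c = 0` the steady-state system reads `r' = r s`, `s' = -s² + φ² + P(r)`, `φ' = -2 s φ + Q(r)`
with `P`, `Q` polynomial, so that `(r² φ)' = r² Q` and `(r² s²)' = 2 r² s (P + φ²)`. Up to the crest
`r` increases, and one may take `x ∈ [0, 1]` with `r² = ρ (1 - x²)` as the independent variable: the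
equilibrium is `x = 1`, the crest is `x = 0`, and `ρ` is the unknown value of `r²` at the crest.
Writing `s = x / τ(x)` and `φ = ε ψ(x)`, the two balance laws express `ψ` as an average of `Q τ / ε`
and turn the system into equations for `(τ, ρ) ∈ C([0, 1]) × ℝ` that are smooth in the unknowns and
in the parameters, including `ε = 0` (`shapeMap`). The singular behaviour of the manifold at both
ends is absorbed by the factors `1 - x²` and `x`. Conversely a zero of these equations yields the
unstable manifold (`exists_branch_of_shape`, `isPhiU_of_shape`).

At `ε = 0` the zero is the explicit profile `R₀` and the linearization is triangular and invertible,
so the implicit function theorem gives `φᵘ(0) = ε X(w, ε, d₁)` with `X` of class `C¹` near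
`(ω, 0, d₁*)` (`exists_phi_family`). At `ε = 0` the function `X` is a Melnikov integral,
`X = -(Λ₄ / (2 ρ)) (d₁ - d₁*(w))` (`shapePhi_base`). Its derivative in `w` at `d₁ = d₁*(ω)` is
`(Λ₄ / (2 ρ)) ∂_ω d₁* = -(Λ₄ / (2 ρ)) ∂_ω Λ₂₄ (b - b*)`. As `∂_ω Λ₂₄ < 0`, it has the sign of
`b - b*`, and by continuity of `∂_w X` so has the derivative for all small `ε` and all `d₁` within
`C ε` of `d₁*` (`exists_phiU_deriv`).

The value `φᵘ(0)` is unique (`isPhiU_unique`): the equilibrium with `s > 0` is unique, since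
`(s + i φ)²` is prescribed there; for two solutions, compared at equal amplitude `r`, the squared
distance between their `(s, φ)` is nonincreasing in `r` near the equilibrium and tends to `0` as
`r → 0`, so it vanishes, and uniqueness for the initial value problem carries this on to the crest.

The ratios of the `Λ_m` reduce to `J(β) = ∫₀¹ dv / (1 - β v²)`: one has `Λ₂ = 4 √ω J(β)`
(`Lam_two`), and integrating `(R₀' / R₀)'` and `(R₀ R₀')'` over the line gives `Λ₄` and `Λ₆`. Hence
`Λ₂₄ = (4 α / 3) J / (1 - J)` for `α ≠ 0`, which is strictly decreasing in `ω` because `J' > 0`. With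
`2 β J' = 1 / (1 - β) - J`, positivity of `∂_ω Λ_{d₂}` for `0 < β < 1` becomes
`J (2 J - 1) < 1 / (1 - β)`, which follows from the duplication formula
`J(4 κ / (1 + κ)²) = (1 + κ) J(κ)` and an elementary bound on `J(κ)` (`J_mul_lt`).
-/

namespace BrightWave

/-! ### The integral `∫₀¹ dv / (1 - β v²)` -/

/-- `J β = ∫₀¹ dv / (1 - β v²)`, that is `artanh √β / √β` for `0 < β < 1`. -/
noncomputable def J (β : ℝ) : ℝ := ∫ v in (0 : ℝ)..1, (1 - β * v ^ 2)⁻¹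

theorem one_sub_mul_sq_pos {β v : ℝ} (hβ : β < 1) (hv : v ^ 2 ≤ 1) : 0 < 1 - β * v ^ 2 := by
  rcases le_or_gt β 0 with h | h
  · nlinarith [sq_nonneg v]
  · nlinarith [sq_nonneg v]

theorem sq_le_one_of_mem_uIcc {v : ℝ} (hv : v ∈ Set.uIcc (0 : ℝ) 1) : v ^ 2 ≤ 1 := by
  rw [Set.uIcc_of_le zero_le_one] at hv
  nlinarith [hv.1, hv.2]

theorem continuousOn_inv_one_sub_mul_sq {β : ℝ} (hβ : β < 1) :
    ContinuousOn (fun v : ℝ => (1 - β * v ^ 2)⁻¹) (Set.uIcc 0 1) :=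
  ContinuousOn.inv₀ (by fun_prop)
    fun _ hv => (one_sub_mul_sq_pos hβ (sq_le_one_of_mem_uIcc hv)).ne'

/-- The derivative of `J`, written so that it is visibly positive. -/
noncomputable def dJ (β : ℝ) : ℝ := ∫ v in (0 : ℝ)..1, v ^ 2 * ((1 - β * v ^ 2) ^ 2)⁻¹

theorem hasDerivAt_J {β : ℝ} (hβ : β < 1) : HasDerivAt J (dJ β) β := by
  set c : ℝ := min 1 ((1 - β) / 2) with hc
  have hc0 : 0 < c := lt_min one_pos (by linarith)
  have key : ∀ x ∈ Set.Iio ((1 + β) / 2), ∀ v ∈ Set.uIcc (0 : ℝ) 1, c ≤ 1 - x * v ^ 2 := by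
    intro x hx v hv
    have h1 := sq_le_one_of_mem_uIcc hv
    rcases le_or_gt x 0 with h | h
    · exact (min_le_left _ _).trans (by nlinarith [sq_nonneg v])
    · refine (min_le_right _ _).trans ?_
      have : x < (1 + β) / 2 := hx
      nlinarith [sq_nonneg v]
  have hmem : Set.Iio ((1 + β) / 2) ∈ 𝓝 β := Iio_mem_nhds (by linarith)
  refine (intervalIntegral.hasDerivAt_integral_of_dominated_loc_of_deriv_le
    (F := fun β v => (1 - β * v ^ 2)⁻¹)
    (F' := fun β v => v ^ 2 * ((1 - β * v ^ 2) ^ 2)⁻¹) (μ := MeasureTheory.volume) (a := 0) (b := 1)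
    (bound := fun _ => (c ^ 2)⁻¹)
    (s := Set.Iio ((1 + β) / 2)) hmem ?_ ?_ ?_ ?_ ?_ ?_).2
  · exact Eventually.of_forall fun x => Measurable.aestronglyMeasurable (by fun_prop)
  · exact (continuousOn_inv_one_sub_mul_sq hβ).intervalIntegrable
  · exact Measurable.aestronglyMeasurable (by fun_prop)
  · refine Eventually.of_forall fun v hv x hx => ?_
    have hv' := Set.uIoc_subset_uIcc hv
    have h1 := key x hx v hv'
    have h2 := sq_le_one_of_mem_uIcc hv'
    rw [Real.norm_of_nonneg (by positivity)]
    calc v ^ 2 * ((1 - x * v ^ 2) ^ 2)⁻¹ ≤ 1 * (c ^ 2)⁻¹ := by gcongr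
      _ = _ := one_mul _
  · exact intervalIntegrable_const
  · refine Eventually.of_forall fun v hv x hx => ?_
    have h1 := key x hx v (Set.uIoc_subset_uIcc hv)
    have h3 : (1 - x * v ^ 2) ≠ 0 := by linarith
    have h4 : HasDerivAt (fun x => 1 - x * v ^ 2) (-(1 * v ^ 2)) x :=
      ((hasDerivAt_id x).mul_const _).const_sub 1
    refine (h4.inv h3).congr_deriv ?_
    field_simp

theorem continuousOn_dJ_integrand {β : ℝ} (hβ : β < 1) :
    ContinuousOn (fun v : ℝ => v ^ 2 * ((1 - β * v ^ 2) ^ 2)⁻¹) (Set.uIcc 0 1) := by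
  refine ContinuousOn.mul (by fun_prop) (ContinuousOn.inv₀ (by fun_prop) fun v hv => ?_)
  exact pow_ne_zero _ (one_sub_mul_sq_pos hβ (sq_le_one_of_mem_uIcc hv)).ne'

theorem dJ_pos {β : ℝ} (hβ : β < 1) : 0 < dJ β := by
  refine intervalIntegral.intervalIntegral_pos_of_pos_on
    (continuousOn_dJ_integrand hβ).intervalIntegrable (fun v hv => ?_) one_pos
  have : 0 < 1 - β * v ^ 2 := one_sub_mul_sq_pos hβ (by nlinarith [hv.1, hv.2])
  have := hv.1
  positivity

/-- The differential equation of `J`, by integrating the derivative of `v / (1 - β v²)`. -/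
theorem two_mul_dJ {β : ℝ} (hβ : β < 1) : 2 * β * dJ β = (1 - β)⁻¹ - J β := by
  have h1 : ∀ v ∈ Set.uIcc (0 : ℝ) 1, HasDerivAt (fun v : ℝ => v * (1 - β * v ^ 2)⁻¹)
      ((1 - β * v ^ 2)⁻¹ + 2 * β * (v ^ 2 * ((1 - β * v ^ 2) ^ 2)⁻¹)) v := by
    intro v hv
    have h3 := (one_sub_mul_sq_pos hβ (sq_le_one_of_mem_uIcc hv)).ne'
    have h4 : HasDerivAt (fun v => 1 - β * v ^ 2) (-(β * (2 * v))) v := by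
      simpa using (((hasDerivAt_id v).pow 2).const_mul β).const_sub 1
    refine ((hasDerivAt_id' v).mul (h4.inv h3)).congr_deriv ?_
    simp only [Pi.inv_apply]
    field_simp
  have hi1 := (continuousOn_inv_one_sub_mul_sq hβ).intervalIntegrable
    (μ := MeasureTheory.volume)
  have hi2 := ((continuousOn_dJ_integrand hβ).intervalIntegrable
    (μ := MeasureTheory.volume)).const_mul (2 * β)
  have h2 := intervalIntegral.integral_eq_sub_of_hasDerivAt h1 (hi1.add hi2)
  rw [intervalIntegral.integral_add hi1 hi2, intervalIntegral.integral_const_mul] at h2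
  simp only [dJ, J]
  norm_num at h2
  linarith

/-- The duplication formula, from the substitution `v = (1 + κ) u / (1 + κ u²)`. -/
theorem J_duplication {κ : ℝ} (h0 : 0 ≤ κ) (h1 : κ < 1) :
    J (4 * κ / (1 + κ) ^ 2) = (1 + κ) * J κ := by
  have hpos : ∀ u : ℝ, 0 < 1 + κ * u ^ 2 := fun u => by positivity
  have hd : ∀ u ∈ Set.uIcc (0 : ℝ) 1, HasDerivAt (fun u => (1 + κ) * u / (1 + κ * u ^ 2))
      ((1 + κ) * (1 - κ * u ^ 2) / (1 + κ * u ^ 2) ^ 2) u := by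
    intro u _
    have h4 : HasDerivAt (fun v => 1 + κ * v ^ 2) (κ * (2 * u)) u := by
      simpa using (((hasDerivAt_id u).pow 2).const_mul κ).const_add 1
    have h5 : HasDerivAt (fun v => (1 + κ) * v) ((1 + κ) * 1) u := (hasDerivAt_id u).const_mul _
    have h6 := (hpos u).ne'
    refine (h5.div h4 h6).congr_deriv ?_
    field_simp
    ring
  have hid : ∀ u ∈ Set.uIcc (0 : ℝ) 1,
      1 - 4 * κ / (1 + κ) ^ 2 * ((1 + κ) * u / (1 + κ * u ^ 2)) ^ 2
        = ((1 - κ * u ^ 2) / (1 + κ * u ^ 2)) ^ 2 := by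
    intro u _
    have := (hpos u).ne'
    field_simp
    ring
  have hsub := intervalIntegral.integral_comp_mul_deriv_of_deriv_nonneg
    (g := fun v => (1 - 4 * κ / (1 + κ) ^ 2 * v ^ 2)⁻¹)
    (fun u hu => (hd u hu).continuousAt.continuousWithinAt)
    (fun u hu => hd u (Set.Ioo_subset_Icc_self hu)) fun u hu => ?_
  · simp only [mul_one, mul_zero, zero_div, one_pow] at hsub
    rw [div_self (by positivity)] at hsub
    rw [J, J, ← hsub, ← intervalIntegral.integral_const_mul]
    refine intervalIntegral.integral_congr fun u hu => ?_
    have h2 := (one_sub_mul_sq_pos h1 (sq_le_one_of_mem_uIcc hu)).ne'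
    have h3 := (hpos u).ne'
    simp only [Function.comp]
    rw [hid u hu]
    field_simp
  · have h2 := one_sub_mul_sq_pos h1 (sq_le_one_of_mem_uIcc (Set.Ioo_subset_Icc_self hu))
    positivity

theorem J_le {κ : ℝ} (h1 : κ < 1) : J κ ≤ 1 + κ / (3 * (1 - κ)) := by
  have h : J κ ≤ ∫ v in (0 : ℝ)..1, (1 + κ / (1 - κ) * v ^ 2) := by
    refine intervalIntegral.integral_mono_on zero_le_one
      (continuousOn_inv_one_sub_mul_sq h1).intervalIntegrable
      (Continuous.intervalIntegrable (by fun_prop) _ _) fun v hv => ?_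
    have hv2 : v ^ 2 ≤ 1 := by nlinarith [hv.1, hv.2]
    have h2 := one_sub_mul_sq_pos h1 hv2
    have h3 : 0 < 1 - κ := by linarith
    rw [inv_le_iff_one_le_mul₀ h2, ← sub_nonneg]
    have : (1 + κ / (1 - κ) * v ^ 2) * (1 - κ * v ^ 2) - 1
        = κ ^ 2 * v ^ 2 * (1 - v ^ 2) / (1 - κ) := by field_simp; ring
    rw [this]
    have : 0 ≤ 1 - v ^ 2 := by linarith
    positivity
  refine h.trans (le_of_eq ?_)
  rw [intervalIntegral.integral_add (by simp) (Continuous.intervalIntegrable (by fun_prop) _ _),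
    intervalIntegral.integral_const_mul, integral_pow]
  have h3 : 1 - κ ≠ 0 := by linarith
  norm_num
  field_simp

theorem one_le_J {κ : ℝ} (h0 : 0 ≤ κ) (h1 : κ < 1) : 1 ≤ J κ := by
  have h : (∫ v in (0 : ℝ)..1, (1 : ℝ)) ≤ J κ := by
    refine intervalIntegral.integral_mono_on zero_le_one (by simp)
      (continuousOn_inv_one_sub_mul_sq h1).intervalIntegrable fun v hv => ?_
    have hv2 : v ^ 2 ≤ 1 := by nlinarith [hv.1, hv.2]
    have h2 := one_sub_mul_sq_pos h1 hv2
    rw [one_le_inv₀ h2]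
    nlinarith [sq_nonneg v]
  simpa using h

/-- The inequality behind the monotonicity of `Λ_{d₂}`. The duplication formula moves it to the
parameter `κ`, where the crude bound on `J` suffices up to `κ = 1`. -/
theorem J_mul_lt {β : ℝ} (h0 : 0 < β) (h1 : β < 1) : J β * (2 * J β - 1) < (1 - β)⁻¹ := by
  set k := √(1 - β) with hk
  have hk2 : k ^ 2 = 1 - β := Real.sq_sqrt (by linarith)
  have hk0 : 0 < k := Real.sqrt_pos.2 (by linarith)
  have hk1 : k < 1 := by nlinarith
  set κ := (1 - k) / (1 + k) with hκ
  have hκ0 : 0 < κ := div_pos (by linarith) (by linarith)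
  have hκ1 : κ < 1 := by rw [hκ, div_lt_one (by linarith)]; linarith
  have hβκ : β = 4 * κ / (1 + κ) ^ 2 := by
    have : β = 1 - k ^ 2 := by linarith
    rw [this, hκ]
    have : 1 + k ≠ 0 := by linarith
    field_simp
    ring
  have hJ : J β = (1 + κ) * J κ := by rw [hβκ, J_duplication hκ0.le hκ1]
  have h3 : 0 < 1 - κ := by linarith
  have hle : J β ≤ (1 + κ) * (1 + κ / (3 * (1 - κ))) := by
    rw [hJ]; exact mul_le_mul_of_nonneg_left (J_le hκ1) (by linarith)
  have hge : 1 ≤ J β := one_le_J h0.le h1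
  set B := (1 + κ) * (1 + κ / (3 * (1 - κ))) with hB
  calc J β * (2 * J β - 1) ≤ B * (2 * B - 1) := by
        apply mul_le_mul hle (by linarith) (by linarith) (by linarith)
    _ < (1 - β)⁻¹ := by
        have h4 : (1 - β)⁻¹ - B * (2 * B - 1)
            = (1 + κ) * κ ^ 2 * (22 - 8 * κ) / (9 * (1 - κ) ^ 2) := by
          have h5 : 1 - β = ((1 - κ) / (1 + κ)) ^ 2 := by rw [hβκ]; field_simp; ring
          rw [h5, hB]
          field_simp
          ring
        have h6 : 0 < 22 - 8 * κ := by linarith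
        have : 0 < (1 + κ) * κ ^ 2 * (22 - 8 * κ) / (9 * (1 - κ) ^ 2) := by positivity
        linarith

section

/-! ### Limits and integrals over the line -/

theorem tendsto_of_odd_of_sq {f : ℝ → ℝ} {c : ℝ} (hodd : ∀ z, f (-z) = -f z)
    (hpos : ∀ z, 0 ≤ z → 0 ≤ f z) (hc : 0 ≤ c)
    (h : Tendsto (fun z => f z ^ 2) atTop (𝓝 (c ^ 2))) :
    Tendsto f atTop (𝓝 c) ∧ Tendsto f atBot (𝓝 (-c)) := by
  have h1 : Tendsto f atTop (𝓝 c) := by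
    have h2 := h.sqrt
    rw [Real.sqrt_sq hc] at h2
    refine h2.congr' ?_
    filter_upwards [eventually_ge_atTop 0] with z hz using Real.sqrt_sq (hpos z hz)
  refine ⟨h1, ?_⟩
  have h3 := (h1.comp tendsto_neg_atBot_atTop).neg
  refine h3.congr fun z => ?_
  simp [hodd]

theorem integrable_deriv_of_nonneg_of_tendsto {g g' : ℝ → ℝ} {l m : ℝ}
    (hd : ∀ z, HasDerivAt g (g' z) z) (hpos : ∀ z, 0 ≤ g' z)
    (hbot : Tendsto g atBot (𝓝 l)) (htop : Tendsto g atTop (𝓝 m)) :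
    MeasureTheory.Integrable g' ∧ ∫ z, g' z = m - l := by
  have h1 : MeasureTheory.IntegrableOn g' (Set.Ioi 0) :=
    MeasureTheory.integrableOn_Ioi_deriv_of_nonneg' (fun z _ => hd z) (fun z _ => hpos z) htop
  have h2 : MeasureTheory.IntegrableOn (fun z => g' (-z)) (Set.Ioi 0) := by
    refine MeasureTheory.integrableOn_Ioi_deriv_of_nonneg' (g := fun z => -g (-z)) (l := -l)
      (fun z _ => ?_) (fun z _ => hpos _) ((hbot.comp tendsto_neg_atTop_atBot).neg)
    exact (((hd (-z)).scomp z (hasDerivAt_neg z)).neg).congr_deriv (by simp)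
  have h3 : MeasureTheory.IntegrableOn g' (Set.Iio 0) := by
    have := h2.comp_neg
    simpa using this
  have h4 : MeasureTheory.Integrable g' := by
    rw [← MeasureTheory.integrableOn_univ, ← Set.Iic_union_Ioi (a := (0 : ℝ))]
    exact ((integrableOn_Iic_iff_integrableOn_Iio (by simp)).2 h3).union h1
  exact ⟨h4, MeasureTheory.integral_of_hasDerivAt_of_tendsto hd h4 hbot htop⟩

theorem tendsto_cosh_atTop : Tendsto Real.cosh atTop atTop := by
  refine tendsto_atTop_mono (fun x => ?_) (Real.tendsto_exp_atTop.atTop_div_const two_pos)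
  rw [Real.cosh_eq]
  have := Real.exp_pos (-x)
  linarith

/-! ### The unperturbed profile -/

/-- `√(1 - β)`. -/
noncomputable def kap (α ω : ℝ) : ℝ := √(1 - beta α ω)

/-- The denominator `1 + √(1 - β) cosh (2 √ω z)` of `R₀²`. -/
noncomputable def denom (α ω z : ℝ) : ℝ := 1 + kap α ω * Real.cosh (2 * √ω * z)

/-- The intensity `R₀²`. -/
noncomputable def rho (α ω z : ℝ) : ℝ := 4 * ω / denom α ω z

/-- The logarithmic derivative `R₀' / R₀`. -/
noncomputable def sig (α ω z : ℝ) : ℝ :=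
  -(√ω * kap α ω * Real.sinh (2 * √ω * z)) / denom α ω z

/-- The intensity `R₀(0)²` at the crest. -/
noncomputable def crest (α ω : ℝ) : ℝ := 4 * ω / (1 + kap α ω)

variable {α ω : ℝ}

theorem kap_pos (hβ : beta α ω < 1) : 0 < kap α ω := Real.sqrt_pos.2 (by linarith)

theorem kap_sq (hβ : beta α ω < 1) : kap α ω ^ 2 = 1 + 16 / 3 * α * ω := by
  rw [kap, Real.sq_sqrt (by linarith), beta]; ring

theorem crest_pos (hω : 0 < ω) (hβ : beta α ω < 1) : 0 < crest α ω := by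
  have := kap_pos hβ
  unfold crest; positivity

theorem mul_crest (hβ : beta α ω < 1) :
    α * crest α ω = 3 / 4 * (kap α ω - 1) := by
  have h := kap_pos hβ
  have h2 := kap_sq hβ
  have h3 : 1 + kap α ω ≠ 0 := by positivity
  unfold crest
  field_simp
  nlinarith

theorem denom_pos (hβ : beta α ω < 1) (z : ℝ) : 0 < denom α ω z := by
  have := kap_pos hβ
  have := Real.cosh_pos (2 * √ω * z)
  unfold denom; positivity

theorem rho_pos (hω : 0 < ω) (hβ : beta α ω < 1) (z : ℝ) : 0 < rho α ω z :=
  div_pos (by positivity) (denom_pos hβ z)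

theorem R0_pow (hω : 0 < ω) (hβ : beta α ω < 1) (m : ℕ) (z : ℝ) :
    R0 α ω z ^ (2 * m) = rho α ω z ^ m := by
  rw [pow_mul]
  congr 1
  exact Real.sq_sqrt (rho_pos hω hβ z).le

theorem hasDerivAt_denom (z : ℝ) :
    HasDerivAt (denom α ω) (2 * √ω * kap α ω * Real.sinh (2 * √ω * z)) z := by
  have h1 : HasDerivAt (fun z => 2 * √ω * z) (2 * √ω * 1) z := (hasDerivAt_id z).const_mul _
  refine ((h1.cosh.const_mul (kap α ω)).const_add 1).congr_deriv ?_
  ring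

theorem hasDerivAt_rho (hβ : beta α ω < 1) (z : ℝ) :
    HasDerivAt (rho α ω) (2 * rho α ω z * sig α ω z) z := by
  have h := (denom_pos hβ z).ne'
  refine ((hasDerivAt_const z (4 * ω)).div (hasDerivAt_denom z) h).congr_deriv ?_
  unfold rho sig
  field_simp
  ring

theorem sig_sq (hω : 0 < ω) (hβ : beta α ω < 1) (z : ℝ) :
    sig α ω z ^ 2 = ω - rho α ω z / 2 - α * rho α ω z ^ 2 / 3 := by
  have h := (denom_pos hβ z).ne'
  have h1 := Real.sq_sqrt hω.le
  have h2 := kap_sq hβ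
  have h3 := Real.cosh_sq (2 * √ω * z)
  unfold sig rho
  rw [neg_div, neg_sq, div_pow, mul_pow, mul_pow, h1]
  field_simp
  unfold denom
  have h4 : Real.sinh (2 * √ω * z) ^ 2 = Real.cosh (2 * √ω * z) ^ 2 - 1 := by linarith
  rw [h4]
  linear_combination (-6) * h2

theorem hasDerivAt_sig (hω : 0 < ω) (hβ : beta α ω < 1) (z : ℝ) :
    HasDerivAt (sig α ω) (-rho α ω z / 2 - 2 / 3 * α * rho α ω z ^ 2) z := by
  have h := (denom_pos hβ z).ne'
  have h0 : HasDerivAt (fun z => 2 * √ω * z) (2 * √ω * 1) z := (hasDerivAt_id z).const_mul _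
  refine ((h0.sinh.const_mul (√ω * kap α ω)).neg.div (hasDerivAt_denom z) h).congr_deriv ?_
  have h1 := Real.sq_sqrt hω.le
  have h2 := kap_sq hβ
  have h3 := Real.cosh_sq (2 * √ω * z)
  unfold rho
  simp only [Pi.neg_apply]
  field_simp
  rw [show √ω * 2 * z = 2 * √ω * z by ring, h1]
  unfold denom
  linear_combination (-12 * ω) * h2 - 12 * ω * kap α ω ^ 2 * h3

theorem tendsto_denom (hω : 0 < ω) (hβ : beta α ω < 1) :
    Tendsto (denom α ω) atTop atTop := by
  have h1 : Tendsto (fun z : ℝ => 2 * √ω * z) atTop atTop :=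
    tendsto_id.const_mul_atTop (by positivity)
  exact tendsto_atTop_add_const_left _ _ ((tendsto_cosh_atTop.comp h1).const_mul_atTop (kap_pos hβ))

theorem denom_neg (z : ℝ) : denom α ω (-z) = denom α ω z := by
  simp [denom, Real.cosh_neg]

theorem rho_neg (z : ℝ) : rho α ω (-z) = rho α ω z := by simp [rho, denom_neg]

theorem sig_neg (z : ℝ) : sig α ω (-z) = -sig α ω z := by
  simp [sig, denom_neg, Real.sinh_neg, neg_div]

theorem tendsto_rho_atTop (hω : 0 < ω) (hβ : beta α ω < 1) :
    Tendsto (rho α ω) atTop (𝓝 0) :=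
  (tendsto_denom hω hβ).const_div_atTop _

theorem tendsto_rho_atBot (hω : 0 < ω) (hβ : beta α ω < 1) :
    Tendsto (rho α ω) atBot (𝓝 0) :=
  ((tendsto_rho_atTop hω hβ).comp tendsto_neg_atBot_atTop).congr fun z => rho_neg z

theorem sinh_arg_nonneg {z : ℝ} (hz : 0 ≤ z) : 0 ≤ Real.sinh (2 * √ω * z) :=
  Real.sinh_nonneg_iff.2 (by positivity)

theorem tendsto_sig (hω : 0 < ω) (hβ : beta α ω < 1) :
    Tendsto (sig α ω) atTop (𝓝 (-√ω)) ∧ Tendsto (sig α ω) atBot (𝓝 (√ω)) := by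
  have h := tendsto_of_odd_of_sq (f := fun z => -sig α ω z) (c := √ω)
    (fun z => by simp [sig_neg]) (fun z hz => ?_) (Real.sqrt_nonneg _) ?_
  · exact ⟨by simpa using h.1.neg, by simpa using h.2.neg⟩
  · have := sinh_arg_nonneg (ω := ω) hz
    have := (denom_pos hβ z).le
    have := (kap_pos hβ).le
    simp only [sig, neg_div, neg_neg]
    positivity
  · simp only [neg_sq, sig_sq hω hβ, Real.sq_sqrt hω.le]
    have h1 := tendsto_rho_atTop hω hβ
    simpa using (h1.div_const 2).const_sub ω |>.sub (((h1.pow 2).const_mul α).div_const 3)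

/-! ### Integrals of powers of the profile -/

/-- The coordinate `X` on the profile in which `R₀² = R₀(0)² (1 - X²)`; it runs from `-1` to `1`. -/
noncomputable def profX (α ω z : ℝ) : ℝ :=
  √(2 * kap α ω) * Real.sinh (√ω * z) / √(denom α ω z)

/-- In the coordinate `X` of the profile, `(R₀' / R₀)² = X² · profS (X²)`. -/
noncomputable def profS (α ρ m : ℝ) : ℝ := ρ * (1 / 2 + α * ρ * (2 - m) / 3)

theorem profX_sq (hβ : beta α ω < 1) (z : ℝ) :
    profX α ω z ^ 2 = 1 - (1 + kap α ω) / denom α ω z := by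
  have h := denom_pos hβ z
  have hk := kap_pos hβ
  unfold profX
  rw [div_pow, mul_pow, Real.sq_sqrt h.le, Real.sq_sqrt (by positivity)]
  field_simp
  have : 2 * √ω * z = 2 * (√ω * z) := by ring
  rw [denom, this, Real.cosh_two_mul, Real.cosh_sq]
  ring

theorem profX_sq_lt_one (hβ : beta α ω < 1) (z : ℝ) : profX α ω z ^ 2 < 1 := by
  have h := denom_pos hβ z
  have hk := kap_pos hβ
  have : 0 < (1 + kap α ω) / denom α ω z := by positivity
  rw [profX_sq hβ]; linarith

theorem rho_eq_crest_mul (hβ : beta α ω < 1) (z : ℝ) :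
    rho α ω z = crest α ω * (1 - profX α ω z ^ 2) := by
  have h := denom_pos hβ z
  have hk := kap_pos hβ
  rw [profX_sq hβ, rho, crest]
  field_simp
  ring

theorem profS_pos (hω : 0 < ω) (hβ : beta α ω < 1) {m : ℝ} (h0 : 0 ≤ m) (h1 : m ≤ 1) :
    0 < profS α (crest α ω) m := by
  have hk := kap_pos hβ
  have h2 := mul_crest hβ
  have h3 := crest_pos hω hβ
  unfold profS
  rw [h2]
  have h4 : 0 < 1 / 2 + 3 / 4 * (kap α ω - 1) * (2 - m) / 3 := by nlinarith
  positivity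

theorem profS_profX (hω : 0 < ω) (hβ : beta α ω < 1) (z : ℝ) :
    √(profS α (crest α ω) (profX α ω z ^ 2))
      = √(2 * kap α ω) * √ω * Real.cosh (√ω * z) / √(denom α ω z) := by
  have h := denom_pos hβ z
  have hk := kap_pos hβ
  have hc := Real.cosh_pos (√ω * z)
  rw [Real.sqrt_eq_iff_mul_self_eq_of_pos (by positivity), ← sq, div_pow, mul_pow, mul_pow,
    Real.sq_sqrt h.le, Real.sq_sqrt (by positivity), Real.sq_sqrt hω.le, profS,
    mul_crest hβ, profX_sq hβ, crest]
  field_simp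
  have : 2 * √ω * z = 2 * (√ω * z) := by ring
  rw [denom, this, Real.cosh_two_mul]
  have := Real.cosh_sq (√ω * z)
  rw [show Real.sinh (√ω * z) ^ 2 = Real.cosh (√ω * z) ^ 2 - 1 by linarith]
  ring

theorem hasDerivAt_profX (hω : 0 < ω) (hβ : beta α ω < 1) (z : ℝ) :
    HasDerivAt (profX α ω)
      ((1 - profX α ω z ^ 2) * √(profS α (crest α ω) (profX α ω z ^ 2))) z := by
  have h := denom_pos hβ z
  have hs := Real.sqrt_pos.2 h
  have h1 : HasDerivAt (fun z => √ω * z) (√ω * 1) z := (hasDerivAt_id z).const_mul _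
  refine ((h1.sinh.const_mul (√(2 * kap α ω))).div ((hasDerivAt_denom z).sqrt h.ne')
    hs.ne').congr_deriv ?_
  rw [profS_profX hω hβ, profX_sq hβ]
  have h2 := Real.sq_sqrt h.le
  have h3 : 2 * √ω * z = 2 * (√ω * z) := by ring
  rw [h3, Real.sinh_two_mul]
  field_simp
  rw [h2, denom, h3, Real.cosh_two_mul]
  have := Real.cosh_sq (√ω * z)
  rw [show Real.sinh (√ω * z) ^ 2 = Real.cosh (√ω * z) ^ 2 - 1 by linarith]
  ring

theorem profX_neg (z : ℝ) : profX α ω (-z) = -profX α ω z := by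
  simp [profX, denom_neg, Real.sinh_neg, neg_div]

theorem tendsto_profX (hω : 0 < ω) (hβ : beta α ω < 1) :
    Tendsto (profX α ω) atTop (𝓝 1) ∧ Tendsto (profX α ω) atBot (𝓝 (-1)) := by
  refine tendsto_of_odd_of_sq profX_neg (fun z hz => ?_) zero_le_one ?_
  · have : 0 ≤ Real.sinh (√ω * z) := Real.sinh_nonneg_iff.2 (by positivity)
    unfold profX; positivity
  · simp only [profX_sq hβ]
    simpa using ((tendsto_denom hω hβ).const_div_atTop (1 + kap α ω)).const_sub 1

theorem integral_even_primitive {g : ℝ → ℝ} (heven : ∀ x, g (-x) = g x) :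
    (∫ x in (0 : ℝ)..(-1), g x) = -∫ x in (0 : ℝ)..1, g x := by
  have := intervalIntegral.integral_comp_neg (a := 0) (b := 1) g
  simp only [heven, neg_zero] at this
  rw [this, intervalIntegral.integral_symm]

/-- Integration along a curve from `-1` to `1` whose speed makes an even function of position the
derivative of its primitive. -/
theorem integral_comp_odd_curve {X X' F : ℝ → ℝ} (hX : ∀ z, HasDerivAt X (X' z) z)
    (hXt : Tendsto X atTop (𝓝 1)) (hXb : Tendsto X atBot (𝓝 (-1)))
    (hX1 : ∀ z, X z ^ 2 < 1) (hF : ContinuousOn F (Set.Icc 0 1))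
    (hpos : ∀ z, 0 ≤ F (X z ^ 2) * X' z) :
    MeasureTheory.Integrable (fun z => F (X z ^ 2) * X' z) ∧
      ∫ z, F (X z ^ 2) * X' z = 2 * ∫ x in (0 : ℝ)..1, F (x ^ 2) := by
  -- Past `±1` the integrand is frozen, so that its primitive is differentiable everywhere.
  set g : ℝ → ℝ := fun x => F (min (x ^ 2) 1) with hg
  have hgc : Continuous g := by
    refine hF.comp_continuous (by fun_prop) fun x => ⟨by positivity, min_le_right _ _⟩
  have hgX : ∀ z, g (X z) = F (X z ^ 2) := fun z => by simp only [hg, min_eq_left (hX1 z).le]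
  have hG : ∀ x, HasDerivAt (fun x => ∫ y in (0 : ℝ)..x, g y) (g x) x := fun x =>
    intervalIntegral.integral_hasDerivAt_right (hgc.intervalIntegrable _ _)
      (hgc.stronglyMeasurableAtFilter _ _) hgc.continuousAt
  have h := integrable_deriv_of_nonneg_of_tendsto
    (g := fun z => ∫ y in (0 : ℝ)..(X z), g y) (g' := fun z => F (X z ^ 2) * X' z)
    (fun z => by simpa only [hgX, Function.comp_def] using (hG (X z)).comp z (hX z)) hpos
    ((hG (-1)).continuousAt.tendsto.comp hXb) ((hG 1).continuousAt.tendsto.comp hXt)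
  refine ⟨h.1, h.2.trans ?_⟩
  rw [integral_even_primitive (fun x => by simp [hg])]
  have : ∫ x in (0 : ℝ)..1, g x = ∫ x in (0 : ℝ)..1, F (x ^ 2) :=
    intervalIntegral.integral_congr fun x hx => by
      simp only [hg, min_eq_left (sq_le_one_of_mem_uIcc hx)]
  rw [this]; ring

theorem integral_rho_pow (hω : 0 < ω) (hβ : beta α ω < 1) (j : ℕ) :
    MeasureTheory.Integrable (fun z => rho α ω z ^ (j + 1)) ∧
      ∫ z, rho α ω z ^ (j + 1) = 2 * (crest α ω ^ (j + 1) *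
        ∫ x in (0 : ℝ)..1, (1 - x ^ 2) ^ j / √(profS α (crest α ω) (x ^ 2))) := by
  have hS : ∀ m ∈ Set.Icc (0 : ℝ) 1, √(profS α (crest α ω) m) ≠ 0 := fun m hm =>
    (Real.sqrt_pos.2 (profS_pos hω hβ hm.1 hm.2)).ne'
  have hrho : ∀ z, crest α ω ^ (j + 1) * ((1 - profX α ω z ^ 2) ^ j
      / √(profS α (crest α ω) (profX α ω z ^ 2))) * ((1 - profX α ω z ^ 2) *
        √(profS α (crest α ω) (profX α ω z ^ 2))) = rho α ω z ^ (j + 1) := by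
    intro z
    have := hS _ ⟨sq_nonneg (profX α ω z), (profX_sq_lt_one hβ z).le⟩
    rw [rho_eq_crest_mul hβ, mul_pow]
    field_simp
    ring
  have h := integral_comp_odd_curve
    (F := fun m => crest α ω ^ (j + 1) * ((1 - m) ^ j / √(profS α (crest α ω) m)))
    (hasDerivAt_profX hω hβ) (tendsto_profX hω hβ).1 (tendsto_profX hω hβ).2
    (profX_sq_lt_one hβ)
    (ContinuousOn.mul (by fun_prop) (ContinuousOn.div (by fun_prop)
      (by unfold profS; fun_prop) hS))
    (fun z => by rw [hrho]; exact pow_nonneg (rho_pos hω hβ z).le _)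
  simp only [hrho, intervalIntegral.integral_const_mul] at h
  exact h

theorem integrable_rho_pow (hω : 0 < ω) (hβ : beta α ω < 1) (j : ℕ) :
    MeasureTheory.Integrable (fun z => rho α ω z ^ (j + 1)) := (integral_rho_pow hω hβ j).1

theorem Lam_two_mul (hω : 0 < ω) (hβ : beta α ω < 1) (m : ℕ) :
    Lam (2 * m) α ω = ∫ z, rho α ω z ^ m := by
  simp only [Lam, R0_pow hω hβ]

theorem Lam_eq (hω : 0 < ω) (hβ : beta α ω < 1) (j : ℕ) :
    Lam (2 * (j + 1)) α ω = 2 * (crest α ω ^ (j + 1) *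
        ∫ x in (0 : ℝ)..1, (1 - x ^ 2) ^ j / √(profS α (crest α ω) (x ^ 2))) := by
  rw [Lam_two_mul hω hβ, (integral_rho_pow hω hβ j).2]

theorem Lam_pos (hω : 0 < ω) (hβ : beta α ω < 1) (j : ℕ) : 0 < Lam (2 * (j + 1)) α ω := by
  rw [Lam_two_mul hω hβ]
  have hp : ∀ z, 0 < rho α ω z ^ (j + 1) := fun z => pow_pos (rho_pos hω hβ z) _
  rw [MeasureTheory.integral_pos_iff_support_of_nonneg (fun z => (hp z).le)
    (integrable_rho_pow hω hβ j)]
  have : Function.support (fun z => rho α ω z ^ (j + 1)) = Set.univ :=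
    Set.eq_univ_of_forall fun z => (hp z).ne'
  simp [this]

/-- `∫ R₀² = 4 √ω J(β)`: the antiderivative of `R₀²` is a primitive of `1 / (1 - β v²)` evaluated
at `v = sinh (2 √ω z) / (√(1 - β) + cosh (2 √ω z))`. -/
theorem Lam_two (hω : 0 < ω) (hβ : beta α ω < 1) : Lam 2 α ω = 4 * √ω * J (beta α ω) := by
  have hk := kap_pos hβ
  have hk2 : beta α ω = 1 - kap α ω ^ 2 := by rw [kap_sq hβ, beta]; ring
  have hs := Real.sqrt_pos.2 hω
  have hE : ∀ z, 0 < kap α ω + Real.cosh (2 * √ω * z) := fun z => by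
    have := Real.cosh_pos (2 * √ω * z); positivity
  have hsq : ∀ z, (Real.sinh (2 * √ω * z) / (kap α ω + Real.cosh (2 * √ω * z))) ^ 2
      = 1 - 2 * kap α ω / (kap α ω + Real.cosh (2 * √ω * z))
        + (kap α ω ^ 2 - 1) / (kap α ω + Real.cosh (2 * √ω * z)) ^ 2 := by
    intro z
    have h1 := (hE z).ne'
    have h2 := Real.cosh_sq (2 * √ω * z)
    field_simp
    linear_combination -h2
  have hd : ∀ z, HasDerivAt
      (fun z => Real.sinh (2 * √ω * z) / (kap α ω + Real.cosh (2 * √ω * z)))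
      (2 * √ω * denom α ω z / (kap α ω + Real.cosh (2 * √ω * z)) ^ 2) z := by
    intro z
    have h1 : HasDerivAt (fun z => 2 * √ω * z) (2 * √ω * 1) z := (hasDerivAt_id z).const_mul _
    refine (h1.sinh.div (h1.cosh.const_add (kap α ω)) (hE z).ne').congr_deriv ?_
    have h2 := Real.cosh_sq (2 * √ω * z)
    have h3 := (hE z).ne'
    unfold denom
    field_simp
    linear_combination h2
  have hone : ∀ z, 1 - beta α ω *
      (Real.sinh (2 * √ω * z) / (kap α ω + Real.cosh (2 * √ω * z))) ^ 2
        = denom α ω z ^ 2 / (kap α ω + Real.cosh (2 * √ω * z)) ^ 2 := by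
    intro z
    have h1 := (hE z).ne'
    have h2 := Real.cosh_sq (2 * √ω * z)
    rw [hk2, div_pow]
    unfold denom
    field_simp
    linear_combination (1 - kap α ω ^ 2) * h2
  have hrho : ∀ z, 2 * √ω * (1 - beta α ω *
      (Real.sinh (2 * √ω * z) / (kap α ω + Real.cosh (2 * √ω * z))) ^ 2)⁻¹ *
        (2 * √ω * denom α ω z / (kap α ω + Real.cosh (2 * √ω * z)) ^ 2) = rho α ω z := by
    intro z
    have h1 := (hE z).ne'
    have h2 := (denom_pos hβ z).ne'
    have h3 := Real.sq_sqrt hω.le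
    rw [hone, rho]
    field_simp
    rw [h3]; ring
  have hEt : Tendsto (fun z => kap α ω + Real.cosh (2 * √ω * z)) atTop atTop := by
    have := (tendsto_denom hω hβ).const_mul_atTop (inv_pos.2 hk)
    refine (tendsto_atTop_add_const_left _ (kap α ω - (kap α ω)⁻¹) this).congr fun z => ?_
    unfold denom
    field_simp
    ring
  have hlim := tendsto_of_odd_of_sq
    (f := fun z => Real.sinh (2 * √ω * z) / (kap α ω + Real.cosh (2 * √ω * z))) (c := 1)
    (fun z => by simp [Real.sinh_neg, Real.cosh_neg, neg_div])
    (fun z hz => div_nonneg (sinh_arg_nonneg hz) (hE z).le) zero_le_one (by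
      simp only [hsq]
      have h2 : Tendsto (fun z => (kap α ω + Real.cosh (2 * √ω * z)) ^ 2) atTop atTop :=
        (tendsto_pow_atTop two_ne_zero).comp hEt
      simpa using ((hEt.const_div_atTop (2 * kap α ω)).const_sub 1).add
        (h2.const_div_atTop (kap α ω ^ 2 - 1)))
  have h := integral_comp_odd_curve (F := fun m => 2 * √ω * (1 - beta α ω * m)⁻¹) hd hlim.1 hlim.2
    (fun z => ?_) (ContinuousOn.mul (by fun_prop) (ContinuousOn.inv₀ (by fun_prop) fun m hm => ?_))
    (fun z => by rw [hrho]; exact (rho_pos hω hβ z).le)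
  · have h2 := h.2
    simp only [hrho, intervalIntegral.integral_const_mul] at h2
    have h3 := Lam_two_mul hω hβ 1
    simp only [mul_one, pow_one] at h3
    rw [h3, h2, J]
    ring
  · have h1 := (hE z)
    have h2 := Real.cosh_sq (2 * √ω * z)
    rw [div_pow, div_lt_one (by positivity)]
    nlinarith [Real.cosh_pos (2 * √ω * z)]
  · have := one_sub_mul_sq_pos (v := √m) hβ (by rw [Real.sq_sqrt hm.1]; exact hm.2)
    rw [Real.sq_sqrt hm.1] at this
    exact this.ne'

end

section

variable {α ω : ℝ}

/-! ### Relations between the integrals -/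

theorem Lam_eq_integral_rho (hω : 0 < ω) (hβ : beta α ω < 1) :
    Lam 2 α ω = ∫ z, rho α ω z ^ 1 ∧ Lam 4 α ω = ∫ z, rho α ω z ^ 2 ∧
      Lam 6 α ω = ∫ z, rho α ω z ^ 3 :=
  ⟨Lam_two_mul hω hβ 1, Lam_two_mul hω hβ 2, Lam_two_mul hω hβ 3⟩

/-- Integration of `(R₀' / R₀)'` over the line. -/
theorem Lam_relation_zero (hω : 0 < ω) (hβ : beta α ω < 1) :
    Lam 2 α ω / 2 + 2 / 3 * α * Lam 4 α ω = 2 * √ω := by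
  obtain ⟨h2, h4, -⟩ := Lam_eq_integral_rho hω hβ
  have i1 := integrable_rho_pow hω hβ 0
  have i2 := integrable_rho_pow hω hβ 1
  have h := MeasureTheory.integral_of_hasDerivAt_of_tendsto
    (f' := fun z => -(1 / 2) * rho α ω z ^ 1 + -(2 / 3 * α) * rho α ω z ^ 2)
    (fun z => (hasDerivAt_sig hω hβ z).congr_deriv (by ring))
    ((i1.const_mul _).add (i2.const_mul _)) (tendsto_sig hω hβ).2 (tendsto_sig hω hβ).1
  rw [MeasureTheory.integral_add (i1.const_mul _) (i2.const_mul _),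
    MeasureTheory.integral_const_mul, MeasureTheory.integral_const_mul, ← h2, ← h4] at h
  linarith

/-- Integration of `(R₀ R₀')'` over the line. -/
theorem Lam_relation_two (hω : 0 < ω) (hβ : beta α ω < 1) :
    ω * Lam 2 α ω = 3 / 4 * Lam 4 α ω + 2 / 3 * α * Lam 6 α ω := by
  obtain ⟨h2, h4, h6⟩ := Lam_eq_integral_rho hω hβ
  have i1 := integrable_rho_pow hω hβ 0
  have i2 := integrable_rho_pow hω hβ 1
  have i3 := integrable_rho_pow hω hβ 2
  have h := MeasureTheory.integral_of_hasDerivAt_of_tendsto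
    (f := fun z => rho α ω z * sig α ω z) (m := 0) (n := 0)
    (f' := fun z => 2 * ω * rho α ω z ^ 1 +
      (-(3 / 2) * rho α ω z ^ 2 + -(4 / 3 * α) * rho α ω z ^ 3))
    (fun z => ((hasDerivAt_rho hβ z).mul (hasDerivAt_sig hω hβ z)).congr_deriv (by
      linear_combination 2 * rho α ω z * sig_sq hω hβ z))
    ((i1.const_mul _).add ((i2.const_mul _).add (i3.const_mul _)))
    (by simpa using (tendsto_rho_atBot hω hβ).mul (tendsto_sig hω hβ).2)
    (by simpa using (tendsto_rho_atTop hω hβ).mul (tendsto_sig hω hβ).1)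
  have hadd := MeasureTheory.integral_add (i1.const_mul (2 * ω))
    ((i2.const_mul (-(3 / 2))).add (i3.const_mul (-(4 / 3 * α))))
  simp only [Pi.add_apply] at hadd
  rw [hadd, MeasureTheory.integral_add (i2.const_mul _) (i3.const_mul _),
    MeasureTheory.integral_const_mul, MeasureTheory.integral_const_mul,
    MeasureTheory.integral_const_mul, ← h2, ← h4, ← h6] at h
  linarith

/-- Integration of `(R₀³ R₀')'` over the line, for `α = 0`. -/
theorem Lam_relation_four (hω : 0 < ω) (hβ : beta 0 ω < 1) :
    4 * ω * Lam 4 0 ω = 5 / 2 * Lam 6 0 ω := by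
  obtain ⟨-, h4, h6⟩ := Lam_eq_integral_rho hω hβ
  have i2 := integrable_rho_pow hω hβ 1
  have i3 := integrable_rho_pow hω hβ 2
  have h := MeasureTheory.integral_of_hasDerivAt_of_tendsto
    (f := fun z => rho 0 ω z ^ 2 * sig 0 ω z) (m := 0) (n := 0)
    (f' := fun z => 4 * ω * rho 0 ω z ^ 2 + -(5 / 2) * rho 0 ω z ^ 3)
    (fun z => (((hasDerivAt_rho hβ z).pow 2).mul (hasDerivAt_sig hω hβ z)).congr_deriv (by
      simp only [Pi.pow_apply]
      push_cast
      linear_combination 4 * rho 0 ω z ^ 2 * sig_sq hω hβ z))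
    ((i2.const_mul _).add (i3.const_mul _))
    (by simpa using ((tendsto_rho_atBot hω hβ).pow 2).mul (tendsto_sig hω hβ).2)
    (by simpa using ((tendsto_rho_atTop hω hβ).pow 2).mul (tendsto_sig hω hβ).1)
  rw [MeasureTheory.integral_add (i2.const_mul _) (i3.const_mul _),
    MeasureTheory.integral_const_mul, MeasureTheory.integral_const_mul, ← h4, ← h6] at h
  linarith

theorem beta_zero_left (ω : ℝ) : beta 0 ω = 0 := by simp [beta]

theorem J_zero : J 0 = 1 := by simp [J]

theorem beta_ne_zero (hα : α ≠ 0) (hω : 0 < ω) : beta α ω ≠ 0 := by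
  unfold beta
  exact mul_ne_zero (mul_ne_zero (by norm_num) hα) hω.ne'

theorem Lam_four_of_ne (hα : α ≠ 0) (hω : 0 < ω) (hβ : beta α ω < 1) :
    Lam 4 α ω = 3 / α * √ω * (1 - J (beta α ω)) := by
  have h := Lam_relation_zero hω hβ
  rw [Lam_two hω hβ] at h
  field_simp
  linarith

theorem Lam_four_zero (hω : 0 < ω) : Lam 4 0 ω = 16 / 3 * ω * √ω := by
  have hβ : beta 0 ω < 1 := by simp [beta]
  have h := Lam_relation_two hω hβ
  rw [Lam_two hω hβ, beta_zero_left, J_zero] at h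
  linarith

theorem one_sub_J_ne_zero (hα : α ≠ 0) (hω : 0 < ω) (hβ : beta α ω < 1) :
    1 - J (beta α ω) ≠ 0 := by
  intro h
  have h4 := Lam_pos hω hβ 1
  rw [show 2 * (1 + 1) = 4 from rfl, Lam_four_of_ne hα hω hβ, h] at h4
  simp at h4

theorem Lam24_of_ne (hα : α ≠ 0) (hω : 0 < ω) (hβ : beta α ω < 1) :
    Lam24 α ω = 4 / 3 * α * (J (beta α ω) / (1 - J (beta α ω))) := by
  have h1 := one_sub_J_ne_zero hα hω hβ
  have h2 := Real.sqrt_pos.2 hω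
  rw [Lam24, Lam_two hω hβ, Lam_four_of_ne hα hω hβ]
  field_simp

theorem Lam24_zero (hω : 0 < ω) : Lam24 0 ω = 3 / 4 * ω⁻¹ := by
  have h2 := Real.sqrt_pos.2 hω
  rw [Lam24, Lam_two hω (by simp [beta]), Lam_four_zero hω, beta_zero_left, J_zero]
  field_simp
  norm_num

theorem mul_Lam24 (hω : 0 < ω) (hβ : beta α ω < 1) :
    ω * Lam24 α ω = 3 / 4 + 2 / 3 * α * (Lam 6 α ω / Lam 4 α ω) := by
  have h4 : 0 < Lam 4 α ω := Lam_pos hω hβ 1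
  have h := Lam_relation_two hω hβ
  rw [Lam24]
  field_simp
  linarith

theorem Lamd2_eq (hω : 0 < ω) (hβ : beta α ω < 1) : Lamd2 α ω = Lam 6 α ω / Lam 4 α ω := by
  unfold Lamd2
  split_ifs with h
  · rfl
  · rw [mul_Lam24 hω hβ]
    have h1 : α ≠ 0 := by rintro rfl; simp [beta] at h
    rw [beta]
    field_simp
    ring

theorem Lamd2_of_ne (hα : α ≠ 0) (hω : 0 < ω) (hβ : beta α ω < 1) :
    Lamd2 α ω = 3 / (2 * α) * (ω * Lam24 α ω - 3 / 4) := by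
  rw [Lamd2_eq hω hβ, mul_Lam24 hω hβ]
  field_simp
  ring

theorem Lamd2_zero (hω : 0 < ω) : Lamd2 0 ω = 8 / 5 * ω := by
  have hβ : beta 0 ω < 1 := by simp [beta]
  have h4 : 0 < Lam 4 0 ω := Lam_pos hω hβ 1
  have h := Lam_relation_four hω hβ
  rw [Lamd2_eq hω hβ]
  field_simp
  linarith

/-! ### Dependence of the ratios on the frequency -/

theorem continuous_beta (α : ℝ) : Continuous (beta α) := by unfold beta; fun_prop

theorem eventually_admissible (hω : 0 < ω) (hβ : beta α ω < 1) :
    ∀ᶠ w in 𝓝 ω, 0 < w ∧ beta α w < 1 :=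
  (lt_mem_nhds hω).and ((continuous_beta α).continuousAt.eventually (gt_mem_nhds hβ))

theorem hasDerivAt_J_beta (hβ : beta α ω < 1) :
    HasDerivAt (fun w => J (beta α w)) (dJ (beta α ω) * (-(16 / 3) * α)) ω := by
  have h : HasDerivAt (beta α) (-(16 / 3) * α * 1) ω := (hasDerivAt_id ω).const_mul _
  exact ((hasDerivAt_J hβ).comp ω h).congr_deriv (by ring)

theorem hasDerivAt_Lam24_of_ne (hα : α ≠ 0) (hω : 0 < ω) (hβ : beta α ω < 1) :
    HasDerivAt (Lam24 α)
      (-(64 / 9) * α ^ 2 * (dJ (beta α ω) / (1 - J (beta α ω)) ^ 2)) ω := by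
  have h1 := one_sub_J_ne_zero hα hω hβ
  have hJ := hasDerivAt_J_beta hβ
  have h2 := ((hJ.div (hJ.const_sub 1) h1).const_mul (4 / 3 * α)).congr_of_eventuallyEq
    (f₁ := Lam24 α) (by
      filter_upwards [eventually_admissible hω hβ] with w hw using Lam24_of_ne hα hw.1 hw.2)
  refine h2.congr_deriv ?_
  field_simp
  ring

theorem hasDerivAt_Lam24_zero (hω : 0 < ω) :
    HasDerivAt (Lam24 0) (-(3 / 4) * (ω ^ 2)⁻¹) ω := by
  have h2 := ((hasDerivAt_inv hω.ne').const_mul (3 / 4)).congr_of_eventuallyEq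
    (f₁ := Lam24 0) (by filter_upwards [lt_mem_nhds hω] with w hw using Lam24_zero hw)
  exact h2.congr_deriv (by ring)

theorem exists_hasDerivAt_Lam24 (hω : 0 < ω) (hβ : beta α ω < 1) :
    ∃ D < 0, HasDerivAt (Lam24 α) D ω := by
  rcases eq_or_ne α 0 with rfl | hα
  · refine ⟨_, ?_, hasDerivAt_Lam24_zero hω⟩
    have : 0 < (ω ^ 2)⁻¹ := by positivity
    linarith
  · refine ⟨_, ?_, hasDerivAt_Lam24_of_ne hα hω hβ⟩
    have h1 := one_sub_J_ne_zero hα hω hβ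
    have h2 := dJ_pos hβ
    have : 0 < α ^ 2 * (dJ (beta α ω) / (1 - J (beta α ω)) ^ 2) := by positivity
    linarith

theorem dLam24_neg (hω : 0 < ω) (hβ : beta α ω < 1) : dLam24 α ω < 0 := by
  obtain ⟨D, hD, h⟩ := exists_hasDerivAt_Lam24 hω hβ
  exact (h.deriv.trans_lt hD : deriv (Lam24 α) ω < 0)

theorem hasDerivAt_Lam24 (hω : 0 < ω) (hβ : beta α ω < 1) :
    HasDerivAt (Lam24 α) (dLam24 α ω) ω := by
  obtain ⟨D, -, h⟩ := exists_hasDerivAt_Lam24 hω hβ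
  exact h.differentiableAt.hasDerivAt

theorem hasDerivAt_Lamd2_of_ne (hα : α ≠ 0) (hω : 0 < ω) (hβ : beta α ω < 1) :
    HasDerivAt (Lamd2 α) (3 / (2 * α) * (Lam24 α ω + ω * dLam24 α ω)) ω := by
  have h2 := ((((hasDerivAt_id' ω).mul (hasDerivAt_Lam24 hω hβ)).sub_const (3 / 4)).const_mul
    (3 / (2 * α))).congr_of_eventuallyEq (f₁ := Lamd2 α) (by
      filter_upwards [eventually_admissible hω hβ] with w hw using Lamd2_of_ne hα hw.1 hw.2)
  exact h2.congr_deriv (by ring)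

theorem hasDerivAt_Lamd2_zero (hω : 0 < ω) : HasDerivAt (Lamd2 0) (8 / 5) ω := by
  have h2 := ((hasDerivAt_id' ω).const_mul (8 / 5)).congr_of_eventuallyEq
    (f₁ := Lamd2 0) (by filter_upwards [lt_mem_nhds hω] with w hw using Lamd2_zero hw)
  exact h2.congr_deriv (by ring)

theorem hasDerivAt_Lamd2 (hω : 0 < ω) (hβ : beta α ω < 1) :
    HasDerivAt (Lamd2 α) (dLamd2 α ω) ω := by
  rcases eq_or_ne α 0 with rfl | hα
  · exact (hasDerivAt_Lamd2_zero hω).differentiableAt.hasDerivAt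
  · exact (hasDerivAt_Lamd2_of_ne hα hω hβ).differentiableAt.hasDerivAt

theorem dLamd2_pos (hω : 0 < ω) (hβ : beta α ω < 1) (h0 : 0 ≤ beta α ω) : 0 < dLamd2 α ω := by
  rcases eq_or_ne α 0 with rfl | hα
  · rw [dLamd2, (hasDerivAt_Lamd2_zero hω).deriv]; norm_num
  · have hb : 0 < beta α ω := lt_of_le_of_ne h0 (beta_ne_zero hα hω).symm
    have hα' : α < 0 := by
      by_contra! h
      have : 0 ≤ 16 / 3 * α * ω := by positivity
      unfold beta at hb
      linarith
    rw [dLamd2, (hasDerivAt_Lamd2_of_ne hα hω hβ).deriv, dLam24,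
      (hasDerivAt_Lam24_of_ne hα hω hβ).deriv, Lam24_of_ne hα hω hβ]
    have h1 := one_sub_J_ne_zero hα hω hβ
    have h2 := two_mul_dJ hβ
    have h3 := J_mul_lt hb hβ
    have h4 : 3 / (2 * α) * (4 / 3 * α * (J (beta α ω) / (1 - J (beta α ω))) +
        ω * (-(64 / 9) * α ^ 2 * (dJ (beta α ω) / (1 - J (beta α ω)) ^ 2)))
        = ((1 - beta α ω)⁻¹ - J (beta α ω) * (2 * J (beta α ω) - 1)) /
          (1 - J (beta α ω)) ^ 2 := by
      have h5 : α * ω = -(3 / 16) * beta α ω := by unfold beta; ring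
      have h6 : (1 - beta α ω)⁻¹ = J (beta α ω) + 2 * beta α ω * dJ (beta α ω) := by linarith
      rw [h6]
      field_simp
      linear_combination (-(192 : ℝ)) * dJ (beta α ω) * h5
    rw [h4]
    exact div_pos (by linarith) (by positivity)

end

section

/-! ### Uniqueness of the unstable manifold -/

/-- A solution on `z ≤ 0` of `r' = r s`, `s' = -s² + φ² + P(r)`, `φ' = -2 s φ + Q(r)` that emanates
from `(0, sp, φp)`, with `r > 0` and with `z = 0` the first zero of `s`. The steady-state system
with `c = 0` has this form. -/
structure UnstableBranch (P Q : ℝ → ℝ) (sp φp : ℝ) (r s φ : ℝ → ℝ) : Prop where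
  deriv_r : ∀ z ≤ 0, HasDerivWithinAt r (r z * s z) (Set.Iic 0) z
  deriv_s : ∀ z ≤ 0, HasDerivWithinAt s (-s z ^ 2 + φ z ^ 2 + P (r z)) (Set.Iic 0) z
  deriv_phi : ∀ z ≤ 0, HasDerivWithinAt φ (-2 * s z * φ z + Q (r z)) (Set.Iic 0) z
  r_pos : ∀ z ≤ 0, 0 < r z
  lim_r : Tendsto r atBot (𝓝 0)
  lim_s : Tendsto s atBot (𝓝 sp)
  lim_phi : Tendsto φ atBot (𝓝 φp)
  s_pos : ∀ z < 0, 0 < s z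
  s_zero : s 0 = 0

namespace UnstableBranch

variable {P Q : ℝ → ℝ} {sp φp : ℝ} {r s φ r₁ s₁ φ₁ r₂ s₂ φ₂ : ℝ → ℝ}

theorem hasDerivAt_r (h : UnstableBranch P Q sp φp r s φ) {z : ℝ} (hz : z < 0) :
    HasDerivAt r (r z * s z) z := (h.deriv_r z hz.le).hasDerivAt (Iic_mem_nhds hz)

theorem hasDerivAt_s (h : UnstableBranch P Q sp φp r s φ) {z : ℝ} (hz : z < 0) :
    HasDerivAt s (-s z ^ 2 + φ z ^ 2 + P (r z)) z := (h.deriv_s z hz.le).hasDerivAt (Iic_mem_nhds hz)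

theorem hasDerivAt_phi (h : UnstableBranch P Q sp φp r s φ) {z : ℝ} (hz : z < 0) :
    HasDerivAt φ (-2 * s z * φ z + Q (r z)) z := (h.deriv_phi z hz.le).hasDerivAt (Iic_mem_nhds hz)

theorem strictMonoOn_r (h : UnstableBranch P Q sp φp r s φ) : StrictMonoOn r (Set.Iic 0) := by
  refine strictMonoOn_of_deriv_pos (convex_Iic 0)
    (fun z hz => (h.deriv_r z hz).continuousWithinAt) fun z hz => ?_
  rw [interior_Iic] at hz
  rw [(h.hasDerivAt_r hz).deriv]
  exact mul_pos (h.r_pos z (le_of_lt hz)) (h.s_pos z hz)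

theorem exists_r_eq (h : UnstableBranch P Q sp φp r s φ) {y : ℝ} (hy : y ∈ Set.Ioo 0 (r 0)) :
    ∃ z < 0, r z = y := by
  obtain ⟨N, hN⟩ := eventually_atBot.1 (h.lim_r.eventually (gt_mem_nhds hy.1))
  have h1 : r (min N 0) < y := hN _ (min_le_left _ _)
  obtain ⟨z, hz, hzy⟩ := intermediate_value_Icc (min_le_right N 0)
    (fun z hz => ((h.deriv_r z hz.2).continuousWithinAt).mono Set.Icc_subset_Iic_self)
    ⟨h1.le, hy.2.le⟩
  refine ⟨z, lt_of_le_of_ne hz.2 ?_, hzy⟩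
  rintro rfl
  exact hy.2.ne' hzy

/-- The amplitude `r` can serve as the independent variable: its inverse function. -/
theorem exists_inverse (h : UnstableBranch P Q sp φp r s φ) :
    ∃ T : ℝ → ℝ, (∀ y ∈ Set.Ioo 0 (r 0), T y < 0 ∧ r (T y) = y ∧
      HasDerivAt T (y * s (T y))⁻¹ y) ∧ Tendsto T (𝓝[>] 0) atBot := by
  choose! T hT using fun y (hy : y ∈ Set.Ioo 0 (r 0)) => h.exists_r_eq hy
  have hmono : StrictMonoOn T (Set.Ioo 0 (r 0)) := by
    intro y hy y' hy' hlt
    by_contra! hle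
    have := h.strictMonoOn_r.monotoneOn (hT y' hy').1.le (hT y hy).1.le hle
    rw [(hT y hy).2, (hT y' hy').2] at this
    exact absurd hlt this.not_gt
  have himage : T '' Set.Ioo 0 (r 0) = Set.Iio 0 := by
    refine Set.Subset.antisymm (fun z ⟨y, hy, hyz⟩ => hyz ▸ (hT y hy).1) fun z hz => ?_
    have hz' : z < 0 := hz
    have hmem : r z ∈ Set.Ioo 0 (r 0) :=
      ⟨h.r_pos z hz'.le, h.strictMonoOn_r hz'.le (Set.mem_Iic.2 le_rfl) hz'⟩
    exact ⟨r z, hmem, h.strictMonoOn_r.injOn (hT _ hmem).1.le hz'.le (hT _ hmem).2⟩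
  refine ⟨T, fun y hy => ⟨(hT y hy).1, (hT y hy).2, ?_⟩, ?_⟩
  · have hnhds : Set.Ioo 0 (r 0) ∈ 𝓝 y := Ioo_mem_nhds hy.1 hy.2
    have hc : ContinuousAt T y := continuousAt_of_monotoneOn_of_image_mem_nhds hmono.monotoneOn
      hnhds (by rw [himage]; exact Iio_mem_nhds (hT y hy).1)
    have hd := h.hasDerivAt_r (hT y hy).1
    rw [(hT y hy).2] at hd
    refine hd.of_local_left_inverse hc (mul_pos hy.1 (h.s_pos _ (hT y hy).1)).ne' ?_
    filter_upwards [hnhds] with x hx using (hT x hx).2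
  · refine tendsto_atBot.2 fun M => ?_
    have hM : r (min M (-1)) ∈ Set.Ioo 0 (r 0) := by
      have : min M (-1) < 0 := (min_le_right _ _).trans_lt (by norm_num)
      exact ⟨h.r_pos _ this.le, h.strictMonoOn_r this.le (Set.mem_Iic.2 le_rfl) this⟩
    filter_upwards [Ioo_mem_nhdsGT hM.1] with y hy
    have hy' : y ∈ Set.Ioo 0 (r 0) := ⟨hy.1, hy.2.trans hM.2⟩
    by_contra! hlt
    have h1 : r (min M (-1)) ≤ r (T y) := h.strictMonoOn_r.monotoneOn
      (Set.mem_Iic.2 ((min_le_right _ _).trans (by norm_num))) (hT y hy').1.le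
      ((min_le_left _ _).trans hlt.le)
    rw [(hT y hy').2] at h1
    exact absurd hy.2 h1.not_gt

/-- The sign behind the decay of the squared distance of two branches. -/
theorem distance_decay {S σ F f A B m : ℝ} (hm : 0 ≤ m) (hσ : 0 < σ) (hS : 4 * m ≤ S * σ)
    (hA : |A| ≤ m) (hB : |B| ≤ m) :
    0 ≤ (S + σ) * σ * ((S - σ) ^ 2 + (F - f) ^ 2) + (S - σ) * ((S - σ) * A + (F - f) * B) := by
  generalize S - σ = x
  generalize F - f = y
  obtain ⟨a1, -⟩ := abs_le.1 hA
  obtain ⟨b1, b2⟩ := abs_le.1 hB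
  have q0 : 0 ≤ x ^ 2 + y ^ 2 := by positivity
  have q1 : 4 * m * (x ^ 2 + y ^ 2) ≤ (S + σ) * σ * (x ^ 2 + y ^ 2) :=
    mul_le_mul_of_nonneg_right (by nlinarith) q0
  have q2 : -m * x ^ 2 ≤ A * x ^ 2 := mul_le_mul_of_nonneg_right a1 (sq_nonneg x)
  have q3 : -m * (x ^ 2 + y ^ 2) ≤ B * (x * y) := by
    rcases le_total 0 (x * y) with h | h
    · nlinarith [mul_le_mul_of_nonneg_right b1 h, sq_nonneg (x - y)]
    · nlinarith [mul_le_mul_of_nonpos_right b2 h, sq_nonneg (x + y)]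
  nlinarith [mul_nonneg hm q0, mul_nonneg hm (sq_nonneg x), mul_nonneg hm (sq_nonneg y)]

/-- Two branches agree near the equilibrium, as curves parametrized by the amplitude: the squared
distance between them is nonincreasing in the amplitude and tends to `0`. -/
theorem exists_common_point (hP : ContinuousAt P 0) (hQ : ContinuousAt Q 0) (hsp : 0 < sp)
    (hps : -sp ^ 2 + φp ^ 2 + P 0 = 0) (hpφ : -2 * sp * φp + Q 0 = 0)
    (h₁ : UnstableBranch P Q sp φp r₁ s₁ φ₁) (h₂ : UnstableBranch P Q sp φp r₂ s₂ φ₂) :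
    ∃ z₁ < 0, ∃ z₂ < 0, r₁ z₁ = r₂ z₂ ∧ s₁ z₁ = s₂ z₂ ∧ φ₁ z₁ = φ₂ z₂ := by
  obtain ⟨T₁, hT₁, hlim₁⟩ := h₁.exists_inverse
  obtain ⟨T₂, hT₂, hlim₂⟩ := h₂.exists_inverse
  have ls₁ := h₁.lim_s.comp hlim₁
  have ls₂ := h₂.lim_s.comp hlim₂
  have lφ₁ := h₁.lim_phi.comp hlim₁
  have lφ₂ := h₂.lim_phi.comp hlim₂
  have lid : Tendsto (fun y : ℝ => y) (𝓝[>] 0) (𝓝 0) := tendsto_nhdsWithin_of_tendsto_nhds tendsto_id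
  have hε : 0 < sp ^ 2 / 16 := by positivity
  have hN : ∀ᶠ y in 𝓝[>] 0, |-s₂ (T₂ y) ^ 2 + φ₂ (T₂ y) ^ 2 + P y| < sp ^ 2 / 16 := by
    have : Tendsto (fun y => -s₂ (T₂ y) ^ 2 + φ₂ (T₂ y) ^ 2 + P y) (𝓝[>] 0) (𝓝 0) := by
      have := ((ls₂.pow 2).neg.add (lφ₂.pow 2)).add (hP.tendsto.comp lid)
      rwa [hps] at this
    simpa using this.abs.eventually (gt_mem_nhds (by simpa using hε))
  have hM : ∀ᶠ y in 𝓝[>] 0, |-2 * s₂ (T₂ y) * φ₂ (T₂ y) + Q y| < sp ^ 2 / 16 := by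
    have : Tendsto (fun y => -2 * s₂ (T₂ y) * φ₂ (T₂ y) + Q y) (𝓝[>] 0) (𝓝 0) := by
      have := ((ls₂.const_mul (-2)).mul lφ₂).add (hQ.tendsto.comp lid)
      rwa [hpφ] at this
    simpa using this.abs.eventually (gt_mem_nhds (by simpa using hε))
  have hall : ∀ᶠ y in 𝓝[>] 0, y ∈ Set.Ioo 0 (r₁ 0) ∧ y ∈ Set.Ioo 0 (r₂ 0) ∧
      sp / 2 < s₁ (T₁ y) ∧ sp / 2 < s₂ (T₂ y) ∧
      |-s₂ (T₂ y) ^ 2 + φ₂ (T₂ y) ^ 2 + P y| < sp ^ 2 / 16 ∧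
      |-2 * s₂ (T₂ y) * φ₂ (T₂ y) + Q y| < sp ^ 2 / 16 := by
    filter_upwards [Ioo_mem_nhdsGT (h₁.r_pos 0 le_rfl), Ioo_mem_nhdsGT (h₂.r_pos 0 le_rfl),
      ls₁.eventually (lt_mem_nhds (half_lt_self hsp)),
      ls₂.eventually (lt_mem_nhds (half_lt_self hsp)), hN, hM] with y a1 a2 a3 a4 a5 a6
    exact ⟨a1, a2, a3, a4, a5, a6⟩
  obtain ⟨δ, hδ, hball⟩ := mem_nhdsGT_iff_exists_Ioo_subset.1 hall
  have hδ : 0 < δ := hδ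
  set w : ℝ → ℝ := fun y => (s₁ (T₁ y) - s₂ (T₂ y)) ^ 2 + (φ₁ (T₁ y) - φ₂ (T₂ y)) ^ 2 with hw
  have hanti : AntitoneOn w (Set.Ioo 0 δ) := by
    have hder : ∀ y ∈ Set.Ioo 0 δ, ∃ w' ≤ 0, HasDerivAt w w' y := by
      intro y hy
      obtain ⟨m1, m2, b1, b2, b3, b4⟩ := hball hy
      obtain ⟨t1, e1, d1⟩ := hT₁ y m1
      obtain ⟨t2, e2, d2⟩ := hT₂ y m2
      have ds1 := (h₁.hasDerivAt_s t1).comp y d1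
      have ds2 := (h₂.hasDerivAt_s t2).comp y d2
      have dφ1 := (h₁.hasDerivAt_phi t1).comp y d1
      have dφ2 := (h₂.hasDerivAt_phi t2).comp y d2
      rw [e1] at ds1 dφ1
      rw [e2] at ds2 dφ2
      refine ⟨_, ?_, ((ds1.sub ds2).pow 2).add ((dφ1.sub dφ2).pow 2)⟩
      simp only [Pi.sub_apply, Function.comp]
      generalize s₁ (T₁ y) = S at *
      generalize s₂ (T₂ y) = σ at *
      generalize φ₁ (T₁ y) = F at *
      generalize φ₂ (T₂ y) = f at *
      have hy0 := hy.1
      have hS : 0 < S := by linarith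
      have hσ : 0 < σ := by linarith
      set A := -σ ^ 2 + f ^ 2 + P y with hA
      set B := -2 * σ * f + Q y with hB
      have hSσ : sp ^ 2 / 4 < S * σ := by nlinarith
      -- The terms quadratic in the two solutions contribute `-(S + σ)` times the squared distance;
      -- the rest is controlled by the smallness of the field `(A, B)` near the equilibrium.
      have key : ((2 : ℕ) * (S - σ) ^ (2 - 1) * ((-S ^ 2 + F ^ 2 + P y) * (y * S)⁻¹ -
          A * (y * σ)⁻¹) + (2 : ℕ) * (F - f) ^ (2 - 1) * ((-2 * S * F + Q y) * (y * S)⁻¹ -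
          B * (y * σ)⁻¹)) = -2 / (y * (S * σ)) * ((S + σ) * σ * ((S - σ) ^ 2 + (F - f) ^ 2)
            + (S - σ) * ((S - σ) * A + (F - f) * B)) := by
        rw [hA, hB]
        push_cast
        field_simp
        ring
      have hpos := distance_decay hε.le hσ (by linarith : 4 * (sp ^ 2 / 16) ≤ S * σ) b3.le b4.le
        (F := F) (f := f)
      rw [key]
      exact mul_nonpos_of_nonpos_of_nonneg
        (div_nonpos_of_nonpos_of_nonneg (by norm_num) (by positivity)) hpos
    refine antitoneOn_of_deriv_nonpos (convex_Ioo 0 δ) (fun y hy => ?_) (fun y hy => ?_)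
      fun y hy => ?_
    · obtain ⟨w', -, hd⟩ := hder y hy
      exact hd.continuousAt.continuousWithinAt
    · rw [interior_Ioo] at hy
      obtain ⟨w', -, hd⟩ := hder y hy
      exact hd.differentiableAt.differentiableWithinAt
    · rw [interior_Ioo] at hy
      obtain ⟨w', hw', hd⟩ := hder y hy
      rwa [hd.deriv]
  have hlimw : Tendsto w (𝓝[>] 0) (𝓝 0) := by
    simpa using ((ls₁.sub ls₂).pow 2).add ((lφ₁.sub lφ₂).pow 2)
  have hmem : δ / 2 ∈ Set.Ioo 0 δ := ⟨by positivity, by linarith⟩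
  have hle : w (δ / 2) ≤ 0 := by
    refine ge_of_tendsto hlimw ?_
    filter_upwards [Ioo_mem_nhdsGT hmem.1] with y hy
    exact hanti ⟨hy.1, hy.2.trans hmem.2⟩ hmem hy.2.le
  obtain ⟨m1, m2, -⟩ := hball hmem
  obtain ⟨t1, e1, -⟩ := hT₁ _ m1
  obtain ⟨t2, e2, -⟩ := hT₂ _ m2
  refine ⟨_, t1, _, t2, e1.trans e2.symm, ?_, ?_⟩
  · have : (s₁ (T₁ (δ / 2)) - s₂ (T₂ (δ / 2))) ^ 2 ≤ 0 := by
      have := sq_nonneg (φ₁ (T₁ (δ / 2)) - φ₂ (T₂ (δ / 2)))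
      simp only [hw] at hle; linarith
    exact sub_eq_zero.1 (pow_eq_zero_iff two_ne_zero |>.1 (le_antisymm this (sq_nonneg _)))
  · have : (φ₁ (T₁ (δ / 2)) - φ₂ (T₂ (δ / 2))) ^ 2 ≤ 0 := by
      have := sq_nonneg (s₁ (T₁ (δ / 2)) - s₂ (T₂ (δ / 2)))
      simp only [hw] at hle; linarith
    exact sub_eq_zero.1 (pow_eq_zero_iff two_ne_zero |>.1 (le_antisymm this (sq_nonneg _)))

/-- The vector field, on `ℝ × ℝ × ℝ`. -/
def field (P Q : ℝ → ℝ) (x : ℝ × ℝ × ℝ) : ℝ × ℝ × ℝ :=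
  (x.1 * x.2.1, -x.2.1 ^ 2 + x.2.2 ^ 2 + P x.1, -2 * x.2.1 * x.2.2 + Q x.1)

theorem hasDerivAt_curve (h : UnstableBranch P Q sp φp r s φ) {z t : ℝ} (hz : z + t < 0) :
    HasDerivAt (fun t => (r (z + t), s (z + t), φ (z + t)))
      (field P Q (r (z + t), s (z + t), φ (z + t))) t := by
  exact (h.hasDerivAt_r hz).comp_const_add z t |>.prodMk <|
    ((h.hasDerivAt_s hz).comp_const_add z t).prodMk ((h.hasDerivAt_phi hz).comp_const_add z t)

theorem continuousOn_curve (h : UnstableBranch P Q sp φp r s φ) (z : ℝ) :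
    ContinuousOn (fun t => (r (z + t), s (z + t), φ (z + t))) (Set.Iic (-z)) := by
  have hm : Set.MapsTo (fun t => z + t) (Set.Iic (-z)) (Set.Iic 0) := fun t ht => by
    have : t ≤ -z := ht
    simp only [Set.mem_Iic]; linarith
  have hc : ContinuousOn (fun t => z + t) (Set.Iic (-z)) := by fun_prop
  exact ContinuousOn.prodMk
    (ContinuousOn.comp (fun z hz => (h.deriv_r z hz).continuousWithinAt) hc hm) <|
    ContinuousOn.prodMk
    (ContinuousOn.comp (fun z hz => (h.deriv_s z hz).continuousWithinAt) hc hm)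
    (ContinuousOn.comp (fun z hz => (h.deriv_phi z hz).continuousWithinAt) hc hm)

theorem phi_zero_eq_of_common_point (hP : ContDiff ℝ 1 P) (hQ : ContDiff ℝ 1 Q)
    (h₁ : UnstableBranch P Q sp φp r₁ s₁ φ₁) (h₂ : UnstableBranch P Q sp φp r₂ s₂ φ₂)
    {z₁ z₂ : ℝ} (hz₁ : z₁ < 0) (hle : z₂ ≤ z₁) (hr : r₁ z₁ = r₂ z₂)
    (hs : s₁ z₁ = s₂ z₂) (hφ : φ₁ z₁ = φ₂ z₂) : φ₁ 0 = φ₂ 0 := by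
  set γ₁ : ℝ → ℝ × ℝ × ℝ := fun t => (r₁ (z₁ + t), s₁ (z₁ + t), φ₁ (z₁ + t)) with hγ₁
  set γ₂ : ℝ → ℝ × ℝ × ℝ := fun t => (r₂ (z₂ + t), s₂ (z₂ + t), φ₂ (z₂ + t)) with hγ₂
  have hc₁ : ContinuousOn γ₁ (Set.Icc 0 (-z₁)) :=
    (h₁.continuousOn_curve z₁).mono Set.Icc_subset_Iic_self
  have hc₂ : ContinuousOn γ₂ (Set.Icc 0 (-z₁)) :=
    (h₂.continuousOn_curve z₂).mono fun t ht => ht.2.trans (by linarith)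
  obtain ⟨R, hR⟩ := ((isCompact_Icc.image_of_continuousOn hc₁).union
    (isCompact_Icc.image_of_continuousOn hc₂)).isBounded.subset_closedBall 0
  have hfield : ContDiff ℝ 1 (field P Q) := by unfold field; fun_prop
  obtain ⟨K, hK⟩ := hfield.contDiffOn.exists_lipschitzOnWith one_ne_zero
    (convex_closedBall (0 : ℝ × ℝ × ℝ) R) (isCompact_closedBall 0 R)
  have heq := ODE_solution_unique_of_mem_Icc_right (v := fun _ => field P Q)
    (s := fun _ => Metric.closedBall 0 R) (fun _ _ => hK) hc₁
    (fun t ht => (h₁.hasDerivAt_curve (by linarith [ht.2])).hasDerivWithinAt)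
    (fun t ht => hR (Or.inl ⟨t, Set.Ico_subset_Icc_self ht, rfl⟩)) hc₂
    (fun t ht => (h₂.hasDerivAt_curve (by linarith [ht.2])).hasDerivWithinAt)
    (fun t ht => hR (Or.inr ⟨t, Set.Ico_subset_Icc_self ht, rfl⟩))
    (by simp only [hγ₁, hγ₂, add_zero, hr, hs, hφ])
  have hend := heq (x := -z₁) ⟨by linarith, le_rfl⟩
  simp only [hγ₁, hγ₂, Prod.mk.injEq, add_neg_cancel] at hend
  obtain ⟨-, e2, e3⟩ := hend
  -- The crest is the first zero of `s`, so the two phases agree.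
  have hz : z₂ + -z₁ = 0 := by
    by_contra hne
    have : z₂ + -z₁ < 0 := lt_of_le_of_ne (by linarith) hne
    have := h₂.s_pos _ this
    rw [← e2, h₁.s_zero] at this
    exact lt_irrefl _ this
  rw [e3, hz]

theorem phi_zero_unique (hP : ContDiff ℝ 1 P) (hQ : ContDiff ℝ 1 Q) (hsp : 0 < sp)
    (hps : -sp ^ 2 + φp ^ 2 + P 0 = 0) (hpφ : -2 * sp * φp + Q 0 = 0)
    (h₁ : UnstableBranch P Q sp φp r₁ s₁ φ₁) (h₂ : UnstableBranch P Q sp φp r₂ s₂ φ₂) :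
    φ₁ 0 = φ₂ 0 := by
  obtain ⟨z₁, hz₁, z₂, hz₂, hr, hs, hφ⟩ := exists_common_point hP.continuous.continuousAt
    hQ.continuous.continuousAt hsp hps hpφ h₁ h₂
  rcases le_total z₂ z₁ with h | h
  · exact phi_zero_eq_of_common_point hP hQ h₁ h₂ hz₁ h hr hs hφ
  · exact (phi_zero_eq_of_common_point hP hQ h₂ h₁ hz₂ h hr.symm hs.symm hφ.symm).symm

end UnstableBranch

/-- An equilibrium with `s > 0` is determined by the square of the complex number `s + i φ`. -/
theorem equilibrium_unique {A B s₁ φ₁ s₂ φ₂ : ℝ} (h₁ : 0 < s₁) (h₂ : 0 < s₂)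
    (hs₁ : -s₁ ^ 2 + φ₁ ^ 2 + A = 0) (hφ₁ : -2 * s₁ * φ₁ + B = 0)
    (hs₂ : -s₂ ^ 2 + φ₂ ^ 2 + A = 0) (hφ₂ : -2 * s₂ * φ₂ + B = 0) : s₁ = s₂ ∧ φ₁ = φ₂ := by
  have h : ((s₁ : ℂ) + φ₁ * Complex.I) ^ 2 = ((s₂ : ℂ) + φ₂ * Complex.I) ^ 2 := by
    apply Complex.ext
    · simp [pow_two]; linarith
    · simp [pow_two]; linarith
  rcases sq_eq_sq_iff_eq_or_eq_neg.1 h with h | h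
  · exact ⟨by simpa using congrArg Complex.re h, by simpa using congrArg Complex.im h⟩
  · have : s₁ = -s₂ := by simpa using congrArg Complex.re h
    linarith

end

/-! ### Construction of a branch from its shape -/

theorem hasDerivAt_tanh (u : ℝ) : HasDerivAt Real.tanh (1 - Real.tanh u ^ 2) u := by
  have hc := (Real.cosh_pos u).ne'
  have h := (Real.hasDerivAt_sinh u).div (Real.hasDerivAt_cosh u) hc
  have he : Real.tanh = Real.sinh / Real.cosh := funext fun x => Real.tanh_eq_sinh_div_cosh x
  rw [← he] at h
  refine h.congr_deriv ?_
  rw [Real.tanh_eq_sinh_div_cosh]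
  field_simp

theorem tendsto_tanh_atTop : Tendsto Real.tanh atTop (𝓝 1) := by
  refine (tendsto_of_odd_of_sq Real.tanh_neg (fun z hz => ?_) zero_le_one ?_).1
  · rw [Real.tanh_eq_sinh_div_cosh]
    exact div_nonneg (Real.sinh_nonneg_iff.2 hz) (Real.cosh_pos z).le
  · have h2 : Tendsto (fun z => Real.cosh z ^ 2) atTop atTop :=
      (tendsto_pow_atTop two_ne_zero).comp tendsto_cosh_atTop
    have h3 := (h2.const_div_atTop 1).const_sub 1
    rw [sub_zero] at h3
    rw [one_pow]
    refine h3.congr fun z => ?_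
    have := (Real.cosh_pos z).ne'
    have := Real.cosh_sq z
    rw [Real.tanh_eq_sinh_div_cosh]
    field_simp
    linarith

/-- The motion along the branch: `x' = -(1 - x²) / τ(x)` on `z ≤ 0`, from `x = 1` at `-∞` to
`x = 0`. -/
theorem exists_motion {τ : ℝ → ℝ} (hτ : Continuous τ) {m : ℝ} (hm : 0 < m) (hmτ : ∀ x, m ≤ τ x) :
    ∃ x : ℝ → ℝ, x 0 = 0 ∧ (∀ z, HasDerivAt x (-(1 - x z ^ 2) / τ (x z)) z) ∧
      (∀ z < 0, 0 < x z) ∧ (∀ z, x z ^ 2 < 1) ∧ Tendsto x atBot (𝓝 1) := by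
  have hpos : ∀ x, 0 < τ x := fun x => hm.trans_le (hmτ x)
  have hc : Continuous fun u => τ (Real.tanh u) := hτ.comp
    (continuous_iff_continuousAt.2 fun u => (hasDerivAt_tanh u).continuousAt)
  set T : ℝ → ℝ := fun y => ∫ u in (0 : ℝ)..y, τ (Real.tanh u) with hT
  have hTd : ∀ y, HasDerivAt T (τ (Real.tanh y)) y := fun y =>
    intervalIntegral.integral_hasDerivAt_right (hc.intervalIntegrable _ _)
      (hc.stronglyMeasurableAtFilter _ _) hc.continuousAt
  have hTc : Continuous T := continuous_iff_continuousAt.2 fun y => (hTd y).continuousAt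
  have hmono : StrictMono T := strictMono_of_deriv_pos fun y => by
    rw [(hTd y).deriv]; exact hpos _
  have hlin : Monotone fun y => T y - m * y := by
    have hd : ∀ y, HasDerivAt (fun y => T y - m * y) (τ (Real.tanh y) - m * 1) y := fun y =>
      (hTd y).sub ((hasDerivAt_id' y).const_mul m)
    refine monotone_of_deriv_nonneg (fun y => (hd y).differentiableAt) fun y => ?_
    rw [(hd y).deriv]
    have := hmτ (Real.tanh y)
    linarith
  have hT0 : T 0 = 0 := by simp [hT]
  have htop : Tendsto T atTop atTop := by
    refine tendsto_atTop_mono' _ ?_ (tendsto_id.const_mul_atTop hm)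
    filter_upwards [eventually_ge_atTop 0] with y hy
    have := hlin hy
    simp only [hT0] at this
    simp only [id]; linarith
  have hbot : Tendsto T atBot atBot := by
    refine tendsto_atBot_mono' _ ?_ (tendsto_id.const_mul_atBot hm)
    filter_upwards [eventually_le_atBot 0] with y hy
    have := hlin hy
    simp only [hT0] at this
    simp only [id]; linarith
  set e := (hmono.orderIsoOfSurjective T (hTc.surjective htop hbot)).symm with he
  have hTe : ∀ z, T (e z) = z := fun z =>
    (hmono.orderIsoOfSurjective T (hTc.surjective htop hbot)).apply_symm_apply z
  have hed : ∀ z, HasDerivAt e (τ (Real.tanh (e z)))⁻¹ z := fun z =>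
    (hTd (e z)).of_local_left_inverse e.continuous.continuousAt (hpos _).ne'
      (Eventually.of_forall hTe)
  have he0 : e 0 = 0 := hmono.injective (by rw [hTe, hT0])
  refine ⟨fun z => Real.tanh (e (-z)), by simp [he0], fun z => ?_, fun z hz => ?_, fun z => ?_, ?_⟩
  · have h1 := (hed (-z)).scomp z (hasDerivAt_neg z)
    refine ((hasDerivAt_tanh (e (-z))).comp z h1).congr_deriv ?_
    simp only [smul_eq_mul]
    ring
  · have h1 : 0 < e (-z) := by
      rw [← he0]; exact e.strictMono (by linarith)
    simp only [Real.tanh_eq_sinh_div_cosh]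
    exact div_pos (Real.sinh_pos_iff.2 h1) (Real.cosh_pos _)
  · exact Real.tanh_sq_lt_one _
  · exact tendsto_tanh_atTop.comp (e.tendsto_atTop.comp tendsto_neg_atBot_atTop)

theorem hasDerivWithinAt_of_left {f F : ℝ → ℝ} (hf : ∀ z < 0, HasDerivAt f (F z) z)
    (hc : ContinuousAt f 0) (hF : ContinuousAt F 0) {z : ℝ} (hz : z ≤ 0) :
    HasDerivWithinAt f (F z) (Set.Iic 0) z := by
  rcases hz.lt_or_eq with h | rfl
  · exact (hf z h).hasDerivWithinAt
  · refine hasDerivWithinAt_Iic_of_tendsto_deriv (s := Set.Iio 0)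
      (fun z hz => (hf z hz).differentiableAt.differentiableWithinAt) hc.continuousWithinAt
      self_mem_nhdsWithin ?_
    refine (hF.tendsto.mono_left nhdsWithin_le_nhds).congr' ?_
    filter_upwards [self_mem_nhdsWithin] with z hz using (hf z hz).deriv.symm

/-- A solution `(ρ, τ, f)` of the two integral equations gives a branch with `r² = ρ (1 - x²)`,
`s = x / τ(x)` and `φ = f(x)`, where `x` runs from `1` to `0`. Multiplied by `ρ`, the
equations are those for `r² φ` and `r² s²` as functions of `r²`. -/
theorem exists_branch_of_shape {P Q : ℝ → ℝ} (hP : Continuous P) (hQ : Continuous Q)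
    {ρ m : ℝ} {τ f : ℝ → ℝ} (hρ : 0 < ρ) (hτ : Continuous τ) (hf : Continuous f) (hm : 0 < m)
    (hmτ : ∀ x, m ≤ τ x)
    (hphi : ∀ x ∈ Set.Icc (0 : ℝ) 1, (1 - x ^ 2) * f x =
      ∫ y in x..1, Q (√(ρ * (1 - y ^ 2))) * τ y)
    (henergy : ∀ x ∈ Set.Icc (0 : ℝ) 1, (1 - x ^ 2) * (x / τ x) ^ 2 =
      ∫ y in x..1, 2 * y * (P (√(ρ * (1 - y ^ 2))) + f y ^ 2)) :
    ∃ r s φ : ℝ → ℝ, UnstableBranch P Q (1 / τ 1) (f 1) r s φ ∧ φ 0 = f 0 := by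
  obtain ⟨x, hx0, hxd, hxpos, hx1, hxlim⟩ := exists_motion hτ hm hmτ
  have hpos : ∀ x, 0 < τ x := fun x => hm.trans_le (hmτ x)
  have hxc : Continuous x := continuous_iff_continuousAt.2 fun z => (hxd z).continuousAt
  have hxlt : ∀ z, x z < 1 := fun z => by nlinarith [hx1 z]
  have hsc : Continuous fun z => x z / τ (x z) :=
    hxc.div (hτ.comp hxc) fun z => (hpos _).ne'
  have hrc : Continuous fun z => √(ρ * (1 - x z ^ 2)) := by fun_prop
  have hfc : Continuous fun z => f (x z) := hf.comp hxc
  have hr2 : ∀ z, 0 < ρ * (1 - x z ^ 2) := fun z => mul_pos hρ (by linarith [hx1 z])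
  have hprim : ∀ {g : ℝ → ℝ}, Continuous g → ∀ y, HasDerivAt (fun x => ∫ y in x..1, g y) (-g y) y :=
    fun hg y => intervalIntegral.integral_hasDerivAt_left (hg.intervalIntegrable _ _)
      (hg.stronglyMeasurableAtFilter _ _) hg.continuousAt
  refine ⟨fun z => √(ρ * (1 - x z ^ 2)), fun z => x z / τ (x z), fun z => f (x z),
    ⟨fun z _ => ?_, fun z hz => ?_, fun z hz => ?_, fun z _ => Real.sqrt_pos.2 (hr2 z),
      ?_, ?_, ?_, fun z hz => div_pos (hxpos z hz) (hpos _), by simp [hx0]⟩, by simp [hx0]⟩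
  · refine (((((hxd z).pow 2).const_sub 1).const_mul ρ).sqrt (hr2 z).ne').hasDerivWithinAt.congr_deriv ?_
    have h1 := Real.sq_sqrt (hr2 z).le
    have h2 := (Real.sqrt_pos.2 (hr2 z)).ne'
    have h3 := (hpos (x z)).ne'
    simp only [Pi.pow_apply]
    field_simp
    rw [h1]
    push_cast
    ring
  · refine hasDerivWithinAt_of_left
      (F := fun z => -(x z / τ (x z)) ^ 2 + f (x z) ^ 2 + P (√(ρ * (1 - x z ^ 2))))
      (fun z hz => ?_) hsc.continuousAt (by fun_prop) hz
    have hx := hxpos z hz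
    have hq : 1 - x z ^ 2 ≠ 0 := by linarith [hx1 z]
    have hs : 0 < x z / τ (x z) := div_pos hx (hpos _)
    have hg : Continuous fun y => 2 * y * (P (√(ρ * (1 - y ^ 2))) + f y ^ 2) := by fun_prop
    have hden : HasDerivAt (fun y : ℝ => 1 - y ^ 2) (-(2 * x z)) (x z) := by
      simpa using ((hasDerivAt_id (x z)).pow 2).const_sub 1
    have hE := ((hprim hg (x z)).div hden hq)
    have heq : ∀ y ∈ Set.Ioo (0 : ℝ) 1,
        (∫ y in y..1, 2 * y * (P (√(ρ * (1 - y ^ 2))) + f y ^ 2)) / (1 - y ^ 2) = (y / τ y) ^ 2 := by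
      intro y hy
      rw [← henergy y (Set.Ioo_subset_Icc_self hy)]
      have : 1 - y ^ 2 ≠ 0 := by nlinarith [hy.1, hy.2]
      field_simp
    have hxz := heq (x z) ⟨hx, hxlt z⟩
    have hd := hE.sqrt (by simp only [Pi.div_apply]; rw [hxz]; positivity)
    have hd2 := hd.congr_of_eventuallyEq (f₁ := fun y => y / τ y) (by
      filter_upwards [Ioo_mem_nhds hx (hxlt z)] with y hy
      simp only [Pi.div_apply]
      rw [heq y hy, Real.sqrt_sq (div_pos hy.1 (hpos y)).le])
    refine (hd2.comp z (hxd z)).congr_deriv ?_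
    have hI : (∫ y in (x z)..1, 2 * y * (P (√(ρ * (1 - y ^ 2))) + f y ^ 2))
        = (x z / τ (x z)) ^ 2 * (1 - x z ^ 2) := by rw [← hxz]; field_simp
    simp only [Pi.div_apply]
    rw [hxz, Real.sqrt_sq hs.le, hI]
    have h3 := (hpos (x z)).ne'
    field_simp
    ring
  · refine hasDerivWithinAt_of_left
      (F := fun z => -2 * (x z / τ (x z)) * f (x z) + Q (√(ρ * (1 - x z ^ 2))))
      (fun z hz => ?_) hfc.continuousAt (by fun_prop) hz
    have hx := hxpos z hz
    have hq : 1 - x z ^ 2 ≠ 0 := by linarith [hx1 z]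
    have hg : Continuous fun y => Q (√(ρ * (1 - y ^ 2))) * τ y := by fun_prop
    have hden : HasDerivAt (fun y : ℝ => 1 - y ^ 2) (-(2 * x z)) (x z) := by
      simpa using ((hasDerivAt_id (x z)).pow 2).const_sub 1
    have hE := ((hprim hg (x z)).div hden hq)
    have heq : ∀ y ∈ Set.Ioo (0 : ℝ) 1,
        (∫ y in y..1, Q (√(ρ * (1 - y ^ 2))) * τ y) / (1 - y ^ 2) = f y := by
      intro y hy
      rw [← hphi y (Set.Ioo_subset_Icc_self hy)]
      have : 1 - y ^ 2 ≠ 0 := by nlinarith [hy.1, hy.2]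
      field_simp
    have hd2 := hE.congr_of_eventuallyEq (f₁ := f) (by
      filter_upwards [Ioo_mem_nhds hx (hxlt z)] with y hy
      exact (heq y hy).symm)
    refine (hd2.comp z (hxd z)).congr_deriv ?_
    rw [← hphi (x z) ⟨hx.le, (hxlt z).le⟩]
    have h3 := (hpos (x z)).ne'
    field_simp
    ring
  · have : Tendsto (fun z => √(ρ * (1 - x z ^ 2))) atBot (𝓝 √(ρ * (1 - 1 ^ 2))) :=
      (((hxlim.pow 2).const_sub 1).const_mul ρ).sqrt
    simpa using this
  · exact hxlim.div (hτ.continuousAt.tendsto.comp hxlim) (hpos 1).ne'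
  · exact hf.continuousAt.tendsto.comp hxlim

/-! ### Averaging operators -/

/-- The extension of a function on `[0, 1]` to the line that is constant outside `[0, 1]`. -/
noncomputable def ext (f : C(unitInterval, ℝ)) : ℝ → ℝ := Set.IccExtend zero_le_one f

theorem continuous_ext (f : C(unitInterval, ℝ)) : Continuous (ext f) := f.continuous.Icc_extend'

theorem ext_coe (f : C(unitInterval, ℝ)) (x : unitInterval) : ext f x = f x :=
  Set.IccExtend_val _ _ x

theorem ext_of_mem (f : C(unitInterval, ℝ)) {x : ℝ} (hx : x ∈ Set.Icc (0 : ℝ) 1) :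
    ext f x = f ⟨x, hx⟩ := Set.IccExtend_of_mem _ _ hx

theorem abs_ext_le (f : C(unitInterval, ℝ)) (x : ℝ) : |ext f x| ≤ ‖f‖ := f.norm_coe_le_norm _

/-- The operator `f ↦ (x ↦ ∫₀¹ w(θ) f(κ(x, θ)) dθ)` on `C([0, 1])`. -/
noncomputable def avgOp (κ : unitInterval → ℝ → ℝ) (w : ℝ → ℝ)
    (hκ : Continuous (Function.uncurry κ)) (hw : Continuous w)
    (hw2 : ∀ θ ∈ Set.uIoc (0 : ℝ) 1, |w θ| ≤ 2) :
    C(unitInterval, ℝ) →L[ℝ] C(unitInterval, ℝ) :=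
  LinearMap.mkContinuous
    { toFun := fun f => ⟨fun x => ∫ θ in (0 : ℝ)..1, w θ * ext f (κ x θ),
        intervalIntegral.continuous_parametric_intervalIntegral_of_continuous' (by
          have := continuous_ext f
          exact (hw.comp continuous_snd).mul (this.comp hκ)) 0 1⟩
      map_add' := fun f g => by
        ext x
        simp only [ContinuousMap.coe_mk, ContinuousMap.add_apply]
        have hc : Continuous (κ x) := hκ.comp (Continuous.prodMk_right x)
        rw [← intervalIntegral.integral_add (f := fun θ => w θ * ext f (κ x θ))
          (g := fun θ => w θ * ext g (κ x θ))
          (Continuous.intervalIntegrable (hw.mul ((continuous_ext f).comp hc)) _ _)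
          (Continuous.intervalIntegrable (hw.mul ((continuous_ext g).comp hc)) _ _)]
        refine intervalIntegral.integral_congr fun θ _ => ?_
        simp only [ext, Set.IccExtend, Function.comp, ContinuousMap.add_apply]
        ring
      map_smul' := fun c f => by
        ext x
        simp only [ContinuousMap.coe_mk, ContinuousMap.smul_apply, RingHom.id_apply, smul_eq_mul]
        rw [← intervalIntegral.integral_const_mul]
        refine intervalIntegral.integral_congr fun θ _ => ?_
        simp only [ext, Set.IccExtend, Function.comp, ContinuousMap.smul_apply, smul_eq_mul]
        ring } 2 (fun f => by
      refine (ContinuousMap.norm_le _ (by positivity)).2 fun x => ?_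
      have := intervalIntegral.norm_integral_le_of_norm_le_const (a := 0) (b := 1)
        (C := 2 * ‖f‖) (f := fun θ => w θ * ext f (κ x θ)) fun θ hθ => by
          rw [norm_mul]
          exact mul_le_mul (hw2 θ hθ) (abs_ext_le f _) (norm_nonneg _) (by norm_num)
      simpa using this)

/-- The average of `f` over `[x, 1]`. -/
noncomputable def avgRight : C(unitInterval, ℝ) →L[ℝ] C(unitInterval, ℝ) :=
  avgOp (fun x θ => x + (1 - x) * θ) (fun _ => 1) (by fun_prop) (by fun_prop) (by norm_num)

/-- The average of `f` over `[0, x]` with respect to the measure `2 y dy`. -/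
noncomputable def avgLeftSq : C(unitInterval, ℝ) →L[ℝ] C(unitInterval, ℝ) :=
  avgOp (fun x θ => x * θ) (fun θ => 2 * θ) (by fun_prop) (by fun_prop) fun θ hθ => by
    rw [Set.uIoc_of_le zero_le_one] at hθ
    rw [abs_of_pos (by linarith [hθ.1])]
    linarith [hθ.2]

/-- The coordinate function on `[0, 1]`. -/
def coordX : C(unitInterval, ℝ) := ⟨fun x => x, by fun_prop⟩

/-- The function `1 / (1 + x)` on `[0, 1]`. -/
noncomputable def recipX : C(unitInterval, ℝ) :=
  ⟨fun x => (1 + (x : ℝ))⁻¹, by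
    refine Continuous.inv₀ (by fun_prop) fun x => ?_
    have := x.2.1
    positivity⟩

/-- The average of `f` over `[x, 1]` with respect to the measure `2 y dy`. -/
noncomputable def avgRightSq : C(unitInterval, ℝ) →L[ℝ] C(unitInterval, ℝ) :=
  (ContinuousLinearMap.mul ℝ C(unitInterval, ℝ) recipX).comp
    (avgRight.comp (ContinuousLinearMap.mul ℝ C(unitInterval, ℝ) ((2 : ℝ) • coordX)))

theorem avgRight_apply (f : C(unitInterval, ℝ)) (x : unitInterval) :
    avgRight f x = ∫ θ in (0 : ℝ)..1, ext f (x + (1 - x) * θ) := by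
  change ∫ θ in (0 : ℝ)..1, 1 * ext f (x + (1 - x) * θ) = _
  simp only [one_mul]

theorem avgLeftSq_apply (f : C(unitInterval, ℝ)) (x : unitInterval) :
    avgLeftSq f x = ∫ θ in (0 : ℝ)..1, 2 * θ * ext f (x * θ) := rfl

theorem avgRightSq_apply (f : C(unitInterval, ℝ)) :
    avgRightSq f = recipX * avgRight ((2 : ℝ) • coordX * f) := rfl

theorem mul_avgRight (f : C(unitInterval, ℝ)) (x : unitInterval) :
    (1 - (x : ℝ)) * avgRight f x = ∫ y in (x : ℝ)..1, ext f y := by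
  rw [avgRight_apply]
  simp

theorem avgRight_one (f : C(unitInterval, ℝ)) : avgRight f 1 = f 1 := by
  rw [avgRight_apply]
  have : ext f 1 = f 1 := ext_coe f 1
  simp [this]

theorem avgRight_zero (f : C(unitInterval, ℝ)) : avgRight f 0 = ∫ y in (0 : ℝ)..1, ext f y := by
  rw [avgRight_apply]; simp

theorem mul_avgLeftSq (f : C(unitInterval, ℝ)) (x : unitInterval) :
    (x : ℝ) ^ 2 * avgLeftSq f x = ∫ y in (0 : ℝ)..x, 2 * y * ext f y := by
  rw [avgLeftSq_apply]
  have := intervalIntegral.smul_integral_comp_mul_left (a := 0) (b := 1)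
    (fun y => 2 * y * ext f y) (x : ℝ)
  simp only [mul_zero, mul_one, smul_eq_mul] at this
  rw [← this, sq, mul_assoc, ← intervalIntegral.integral_const_mul]
  congr 1
  exact intervalIntegral.integral_congr fun θ _ => by ring

theorem mul_avgRightSq (f : C(unitInterval, ℝ)) (x : unitInterval) :
    (1 - (x : ℝ) ^ 2) * avgRightSq f x = ∫ y in (x : ℝ)..1, 2 * y * ext f y := by
  have hx : 1 + (x : ℝ) ≠ 0 := by have := x.2.1; positivity
  have h := mul_avgRight ((2 : ℝ) • coordX * f) x
  rw [avgRightSq_apply, ContinuousMap.mul_apply]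
  have h1 : recipX x = (1 + (x : ℝ))⁻¹ := rfl
  rw [h1]
  have h2 : (1 - (x : ℝ) ^ 2) * ((1 + (x : ℝ))⁻¹ * avgRight ((2 : ℝ) • coordX * f) x)
      = (1 - (x : ℝ)) * avgRight ((2 : ℝ) • coordX * f) x := by field_simp; ring
  rw [h2, h]
  refine intervalIntegral.integral_congr fun y hy => ?_
  rw [Set.uIcc_of_le x.2.2] at hy
  have hy' : y ∈ Set.Icc (0 : ℝ) 1 := ⟨x.2.1.trans hy.1, hy.2⟩
  simp only [ext_of_mem _ hy', ContinuousMap.mul_apply, ContinuousMap.smul_apply, smul_eq_mul]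
  rfl

theorem avgRightSq_one (f : C(unitInterval, ℝ)) : avgRightSq f 1 = f 1 := by
  rw [avgRightSq_apply, ContinuousMap.mul_apply, avgRight_one]
  have h1 : recipX 1 = (1 + (1 : ℝ))⁻¹ := rfl
  have h2 : coordX 1 = 1 := rfl
  simp only [ContinuousMap.mul_apply, ContinuousMap.smul_apply, smul_eq_mul, h1, h2]
  ring

/-- The two averages are coupled by their common value over `[0, 1]`. -/
theorem mul_avg_sub_avg (f : C(unitInterval, ℝ)) (x : unitInterval) :
    (1 - (x : ℝ) ^ 2) * (x : ℝ) ^ 2 * (avgLeftSq f x - avgRightSq f x) =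
      (1 - (x : ℝ) ^ 2) * avgLeftSq f 1 - ∫ y in (x : ℝ)..1, 2 * y * ext f y := by
  have h1 := mul_avgLeftSq f x
  have h2 := mul_avgRightSq f x
  have h3 := mul_avgLeftSq f 1
  have hc : Continuous fun y => 2 * y * ext f y := by
    have := continuous_ext f
    fun_prop
  have h4 := intervalIntegral.integral_add_adjacent_intervals
    (hc.intervalIntegrable (μ := MeasureTheory.volume) 0 x)
    (hc.intervalIntegrable (μ := MeasureTheory.volume) x 1)
  simp only [Set.Icc.coe_one, one_pow, one_mul] at h3
  rw [← h3, ← h1] at h4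
  linear_combination (1 - (x : ℝ) ^ 2) * h4 - (x : ℝ) ^ 2 * h2

section

/-! ### The shape equations -/

/-- The cubic-quintic polynomial in the equation for `φ'`, along `r² = ρ (1 - x²)`. -/
noncomputable def forcing (α a b d₂ w d ρ : ℝ) : C(unitInterval, ℝ) :=
  (b + a * w) • 1 + ((d - a) * ρ) • (1 - coordX ^ 2) + ((d₂ - a * α) * ρ ^ 2) • (1 - coordX ^ 2) ^ 2

/-- The function `φ / ε` along the branch, for the parameters `p = (w, ε, d)` (frequency, `ε` and
`d₁`) and the shape `e = (τ, ρ)`, where `τ = x / s` and `ρ` is the value of `r²` at the crest. -/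
noncomputable def shapePhi (α a b d₂ : ℝ) (p : ℝ × ℝ × ℝ) (e : C(unitInterval, ℝ) × ℝ) :
    C(unitInterval, ℝ) :=
  (-(Del a p.2.1)⁻¹) • (recipX * avgRight (forcing α a b d₂ p.1 p.2.2 e.2 * e.1))

/-- The function `Δ s² / x²` along the branch, from the energy balance. -/
noncomputable def shapeStiff (α a b d₂ : ℝ) (p : ℝ × ℝ × ℝ) (e : C(unitInterval, ℝ) × ℝ) :
    C(unitInterval, ℝ) :=
  ((1 + p.2.1 ^ 2 * a * p.2.2) * e.2 / 2) • 1
    + ((α + p.2.1 ^ 2 * a * d₂) * e.2 ^ 2 / 3) • ((2 : ℝ) • 1 - coordX ^ 2)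
    - (p.2.1 ^ 2 * Del a p.2.1) •
      (avgLeftSq (shapePhi α a b d₂ p e ^ 2) - avgRightSq (shapePhi α a b d₂ p e ^ 2))

/-- The equations for the shape `(τ, ρ)`: `τ² s² = x²`, and `s = 0` at the crest. -/
noncomputable def shapeMap (α a b d₂ : ℝ) (q : (ℝ × ℝ × ℝ) × (C(unitInterval, ℝ) × ℝ)) :
    C(unitInterval, ℝ) × ℝ :=
  (q.2.1 ^ 2 * shapeStiff α a b d₂ q.1 q.2 - Del a q.1.2.1 • 1,
    q.1.1 - q.1.2.1 ^ 2 * a * b - (1 + q.1.2.1 ^ 2 * a * q.1.2.2) * q.2.2 / 2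
      - (α + q.1.2.1 ^ 2 * a * d₂) * q.2.2 ^ 2 / 3
      + q.1.2.1 ^ 2 * Del a q.1.2.1 * avgLeftSq (shapePhi α a b d₂ q.1 q.2 ^ 2) 1)

variable {α a b d₂ : ℝ}

theorem Del_pos (a ε : ℝ) : 0 < Del a ε := by unfold Del; positivity

theorem contDiff_shapePhi : ContDiff ℝ 1
    fun q : (ℝ × ℝ × ℝ) × (C(unitInterval, ℝ) × ℝ) => shapePhi α a b d₂ q.1 q.2 := by
  unfold shapePhi forcing
  have h : ∀ q : (ℝ × ℝ × ℝ) × (C(unitInterval, ℝ) × ℝ), Del a q.1.2.1 ≠ 0 :=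
    fun q => (Del_pos _ _).ne'
  unfold Del at *
  fun_prop (disch := assumption)

theorem contDiff_shapeMap : ContDiff ℝ 1 (shapeMap α a b d₂) := by
  have h := contDiff_shapePhi (α := α) (a := a) (b := b) (d₂ := d₂)
  have h2 : ContDiff ℝ 1 fun q : (ℝ × ℝ × ℝ) × (C(unitInterval, ℝ) × ℝ) =>
      avgLeftSq (shapePhi α a b d₂ q.1 q.2 ^ 2) 1 :=
    ((ContinuousMap.evalCLM ℝ (1 : unitInterval)).comp avgLeftSq).contDiff.comp (h.pow 2)
  unfold shapeMap shapeStiff Del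
  fun_prop

theorem forcing_apply (w d ρ : ℝ) (x : unitInterval) :
    forcing α a b d₂ w d ρ x = (b + a * w) + (d - a) * (ρ * (1 - (x : ℝ) ^ 2))
      + (d₂ - a * α) * (ρ * (1 - (x : ℝ) ^ 2)) ^ 2 := by
  have h2 : coordX x = (x : ℝ) := rfl
  simp only [forcing, ContinuousMap.add_apply, ContinuousMap.smul_apply, ContinuousMap.sub_apply,
    ContinuousMap.pow_apply, ContinuousMap.one_apply, smul_eq_mul, h2]
  ring

theorem shapePhi_apply (p : ℝ × ℝ × ℝ) (e : C(unitInterval, ℝ) × ℝ) (x : unitInterval) :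
    shapePhi α a b d₂ p e x = -(Del a p.2.1)⁻¹ * ((1 + (x : ℝ))⁻¹ *
      avgRight (forcing α a b d₂ p.1 p.2.2 e.2 * e.1) x) := rfl

theorem shapeStiff_apply (p : ℝ × ℝ × ℝ) (e : C(unitInterval, ℝ) × ℝ) (x : unitInterval) :
    shapeStiff α a b d₂ p e x = (1 + p.2.1 ^ 2 * a * p.2.2) * e.2 / 2
      + (α + p.2.1 ^ 2 * a * d₂) * e.2 ^ 2 / 3 * (2 - (x : ℝ) ^ 2)
      - p.2.1 ^ 2 * Del a p.2.1 * (avgLeftSq (shapePhi α a b d₂ p e ^ 2) x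
        - avgRightSq (shapePhi α a b d₂ p e ^ 2) x) := by
  have h2 : coordX x = (x : ℝ) := rfl
  simp only [shapeStiff, ContinuousMap.add_apply, ContinuousMap.smul_apply, ContinuousMap.sub_apply,
    ContinuousMap.pow_apply, ContinuousMap.one_apply, smul_eq_mul, h2]
  ring

theorem shapeMap_eq_zero_iff (p : ℝ × ℝ × ℝ) (e : C(unitInterval, ℝ) × ℝ) :
    shapeMap α a b d₂ (p, e) = 0 ↔
      (∀ x, e.1 x ^ 2 * shapeStiff α a b d₂ p e x = Del a p.2.1) ∧
      p.1 - p.2.1 ^ 2 * a * b - (1 + p.2.1 ^ 2 * a * p.2.2) * e.2 / 2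
        - (α + p.2.1 ^ 2 * a * d₂) * e.2 ^ 2 / 3
        + p.2.1 ^ 2 * Del a p.2.1 * avgLeftSq (shapePhi α a b d₂ p e ^ 2) 1 = 0 := by
  rw [shapeMap, Prod.mk_eq_zero, sub_eq_zero, ContinuousMap.ext_iff]
  simp [ContinuousMap.mul_apply]

/-! ### From the shape to the unstable manifold -/

/-- The part of the equation for `s'` that depends on `r`. -/
noncomputable def sPoly (α a b d₂ w ε d r : ℝ) : ℝ :=
  (w - ε ^ 2 * a * b - (1 + ε ^ 2 * a * d) * r ^ 2 - (α + ε ^ 2 * a * d₂) * r ^ 4) / Del a ε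

/-- The part of the equation for `φ'` that depends on `r`. -/
noncomputable def phiPoly (α a b d₂ w ε d r : ℝ) : ℝ :=
  -ε * ((b + a * w) + (d - a) * r ^ 2 + (d₂ - a * α) * r ^ 4) / Del a ε

theorem contDiff_sPoly (w ε d : ℝ) : ContDiff ℝ 1 (sPoly α a b d₂ w ε d) := by
  unfold sPoly; fun_prop

theorem contDiff_phiPoly (w ε d : ℝ) : ContDiff ℝ 1 (phiPoly α a b d₂ w ε d) := by
  unfold phiPoly; fun_prop

theorem sField_eq (w ε d r s φ : ℝ) : sField α a b d d₂ ε 0 w r s φ =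
    -s ^ 2 + φ ^ 2 + sPoly α a b d₂ w ε d r := by
  have := (Del_pos a ε).ne'
  unfold sField sPoly
  field_simp
  ring

theorem phiField_eq (w ε d r s φ : ℝ) : phiField α a b d d₂ ε 0 w r s φ =
    -2 * s * φ + phiPoly α a b d₂ w ε d r := by
  have := (Del_pos a ε).ne'
  unfold phiField phiPoly
  field_simp
  ring

theorem isPhiU_iff (w ε d x : ℝ) : IsPhiU α a b d d₂ ε 0 w x ↔
    ∃ sp φp : ℝ, 0 < sp ∧ -sp ^ 2 + φp ^ 2 + sPoly α a b d₂ w ε d 0 = 0 ∧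
      -2 * sp * φp + phiPoly α a b d₂ w ε d 0 = 0 ∧ ∃ r s φ : ℝ → ℝ,
        UnstableBranch (sPoly α a b d₂ w ε d) (phiPoly α a b d₂ w ε d) sp φp r s φ ∧ φ 0 = x := by
  constructor
  · rintro ⟨r, s, φ, h, hx⟩
    obtain ⟨sp, φp, hsp, h1, h2, l1, l2, l3⟩ := h.tendsto_p
    rw [sField_eq] at h1
    rw [phiField_eq] at h2
    exact ⟨sp, φp, hsp, h1, h2, r, s, φ, ⟨h.deriv_r, by simpa only [sField_eq] using h.deriv_s,
      by simpa only [phiField_eq] using h.deriv_phi, h.r_pos, l1, l2, l3, h.s_pos, h.s_zero⟩, hx⟩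
  · rintro ⟨sp, φp, hsp, h1, h2, r, s, φ, h, hx⟩
    exact ⟨r, s, φ, ⟨h.deriv_r, by simpa only [sField_eq] using h.deriv_s,
      by simpa only [phiField_eq] using h.deriv_phi, h.r_pos,
      ⟨sp, φp, hsp, by rwa [sField_eq], by rwa [phiField_eq], h.lim_r, h.lim_s, h.lim_phi⟩,
      h.s_pos, h.s_zero⟩, hx⟩

theorem isPhiU_unique {w ε d x y : ℝ} (hx : IsPhiU α a b d d₂ ε 0 w x)
    (hy : IsPhiU α a b d d₂ ε 0 w y) : x = y := by
  obtain ⟨sp, φp, hsp, h1, h2, r, s, φ, h, rfl⟩ := (isPhiU_iff w ε d x).1 hx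
  obtain ⟨sp', φp', hsp', h1', h2', r', s', φ', h', rfl⟩ := (isPhiU_iff w ε d y).1 hy
  obtain ⟨rfl, rfl⟩ := equilibrium_unique hsp hsp' h1 h2 h1' h2'
  exact UnstableBranch.phi_zero_unique (contDiff_sPoly w ε d) (contDiff_phiPoly w ε d) hsp h1 h2 h h'

theorem integral_sPoly (w ε d ρ x : ℝ) (hρ : 0 ≤ ρ) (hx : x ∈ Set.Icc (0 : ℝ) 1) :
    ∫ y in x..1, 2 * y * sPoly α a b d₂ w ε d (√(ρ * (1 - y ^ 2))) =
      (1 - x ^ 2) * ((w - ε ^ 2 * a * b) - (1 + ε ^ 2 * a * d) * ρ * (1 - x ^ 2) / 2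
        - (α + ε ^ 2 * a * d₂) * ρ ^ 2 * (1 - x ^ 2) ^ 2 / 3) / Del a ε := by
  have hD := (Del_pos a ε).ne'
  have hd : ∀ y ∈ Set.uIcc x 1, HasDerivAt (fun y : ℝ =>
      -((1 - y ^ 2) * ((w - ε ^ 2 * a * b) - (1 + ε ^ 2 * a * d) * ρ * (1 - y ^ 2) / 2
        - (α + ε ^ 2 * a * d₂) * ρ ^ 2 * (1 - y ^ 2) ^ 2 / 3) / Del a ε))
      (2 * y * sPoly α a b d₂ w ε d (√(ρ * (1 - y ^ 2)))) y := by
    intro y hy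
    rw [Set.uIcc_of_le hx.2] at hy
    have h1 : 0 ≤ ρ * (1 - y ^ 2) := mul_nonneg hρ (by nlinarith [hy.1, hy.2, hx.1])
    have h2 := Real.sq_sqrt h1
    have h4 : √(ρ * (1 - y ^ 2)) ^ 4 = (ρ * (1 - y ^ 2)) ^ 2 := by
      rw [← h2, ← pow_mul, Real.sqrt_sq (Real.sqrt_nonneg _)]
    have ht : HasDerivAt (fun y : ℝ => 1 - y ^ 2) (-(2 * y)) y := by
      simpa using ((hasDerivAt_id y).pow 2).const_sub 1
    have := (((ht.mul (((ht.const_mul ((1 + ε ^ 2 * a * d) * ρ)).div_const 2).const_sub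
      (w - ε ^ 2 * a * b) |>.sub (((ht.pow 2).const_mul
        ((α + ε ^ 2 * a * d₂) * ρ ^ 2)).div_const 3))).div_const (Del a ε))).neg
    refine this.congr_deriv ?_
    simp only [sPoly, h2, h4, Pi.sub_apply, Pi.pow_apply]
    push_cast
    field_simp
    ring
  have hc : Continuous fun y => 2 * y * sPoly α a b d₂ w ε d (√(ρ * (1 - y ^ 2))) := by
    have := (contDiff_sPoly (α := α) (a := a) (b := b) (d₂ := d₂) w ε d).continuous
    fun_prop
  rw [intervalIntegral.integral_eq_sub_of_hasDerivAt hd (hc.intervalIntegrable _ _)]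
  ring

/-- A zero of the shape equations gives the unstable manifold. -/
theorem isPhiU_of_shape {w ε d ρ : ℝ} {τ : C(unitInterval, ℝ)} (hρ : 0 < ρ) (hτ : ∀ x, 0 < τ x)
    (h : shapeMap α a b d₂ ((w, ε, d), (τ, ρ)) = 0) :
    IsPhiU α a b d d₂ ε 0 w (ε * shapePhi α a b d₂ (w, ε, d) (τ, ρ) 0) := by
  rw [shapeMap_eq_zero_iff] at h
  obtain ⟨h1, h2⟩ := h
  simp only at h1 h2
  set ψ := shapePhi α a b d₂ (w, ε, d) (τ, ρ) with hψ
  have hD := Del_pos a ε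
  have hψx : ∀ x, ψ x = -(Del a ε)⁻¹ * ((1 + (x : ℝ))⁻¹ *
      avgRight (forcing α a b d₂ w d ρ * τ) x) := fun x => shapePhi_apply _ _ x
  have hSx := fun x => shapeStiff_apply (α := α) (a := a) (b := b) (d₂ := d₂) (w, ε, d) (τ, ρ) x
  simp only [← hψ] at hSx
  obtain ⟨x₀, -, hx₀⟩ := isCompact_univ.exists_isMinOn (Set.univ_nonempty) τ.continuous.continuousOn
  have hmin : ∀ y, τ x₀ ≤ ext τ y := fun y => hx₀ (Set.mem_univ _)
  have hτ1 : ext τ 1 = τ 1 := ext_coe τ 1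
  have hψ1 : ext ψ 1 = ψ 1 := ext_coe ψ 1
  have hψ0 : ext ψ 0 = ψ 0 := ext_coe ψ 0
  have hSe : ∀ x, 1 / τ x ^ 2 = shapeStiff α a b d₂ (w, ε, d) (τ, ρ) x / Del a ε := fun x => by
    have := (hτ x).ne'
    have := h1 x
    field_simp
    linarith
  have hphi : ∀ x ∈ Set.Icc (0 : ℝ) 1, (1 - x ^ 2) * (ε * ext ψ x) =
      ∫ y in x..1, phiPoly α a b d₂ w ε d (√(ρ * (1 - y ^ 2))) * ext τ y := by
    intro x hx
    have h3 := hψx ⟨x, hx⟩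
    have h4 := mul_avgRight (forcing α a b d₂ w d ρ * τ) ⟨x, hx⟩
    simp only at h3 h4
    have h5 : 1 + x ≠ 0 := by linarith [hx.1]
    have h6 : (1 - x ^ 2) * (ε * ext ψ x) = -(ε * (Del a ε)⁻¹) *
        ((1 - x) * avgRight (forcing α a b d₂ w d ρ * τ) ⟨x, hx⟩) := by
      rw [ext_of_mem ψ hx, h3]
      field_simp
      ring
    rw [h6, h4, ← intervalIntegral.integral_const_mul]
    refine intervalIntegral.integral_congr fun y hy => ?_
    rw [Set.uIcc_of_le hx.2] at hy
    have hy' : y ∈ Set.Icc (0 : ℝ) 1 := ⟨hx.1.trans hy.1, hy.2⟩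
    have h7 : 0 ≤ ρ * (1 - y ^ 2) := mul_nonneg hρ.le (by nlinarith [hy'.1, hy'.2])
    have h8 := Real.sq_sqrt h7
    have h9 : √(ρ * (1 - y ^ 2)) ^ 4 = (ρ * (1 - y ^ 2)) ^ 2 := by
      rw [← h8, ← pow_mul, Real.sqrt_sq (Real.sqrt_nonneg _)]
    simp only [ext_of_mem _ hy', ContinuousMap.mul_apply, forcing_apply, phiPoly, h8, h9]
    field_simp
  have henergy : ∀ x ∈ Set.Icc (0 : ℝ) 1, (1 - x ^ 2) * (x / ext τ x) ^ 2 =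
      ∫ y in x..1, 2 * y * (sPoly α a b d₂ w ε d (√(ρ * (1 - y ^ 2))) + (ε * ext ψ y) ^ 2) := by
    intro x hx
    have hc1 : Continuous fun y => 2 * y * sPoly α a b d₂ w ε d (√(ρ * (1 - y ^ 2))) := by
      have := (contDiff_sPoly (α := α) (a := a) (b := b) (d₂ := d₂) w ε d).continuous
      fun_prop
    have hc2 : Continuous fun y => ε ^ 2 * (2 * y * ext (ψ ^ 2) y) := by
      have := continuous_ext (ψ ^ 2)
      fun_prop
    have hsplit : ∫ y in x..1, 2 * y * (sPoly α a b d₂ w ε d (√(ρ * (1 - y ^ 2)))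
        + (ε * ext ψ y) ^ 2) = (∫ y in x..1, 2 * y * sPoly α a b d₂ w ε d (√(ρ * (1 - y ^ 2))))
        + ε ^ 2 * ∫ y in x..1, 2 * y * ext (ψ ^ 2) y := by
      rw [← intervalIntegral.integral_const_mul, ← intervalIntegral.integral_add
        (hc1.intervalIntegrable _ _) (hc2.intervalIntegrable _ _)]
      refine intervalIntegral.integral_congr fun y hy => ?_
      have : ext (ψ ^ 2) y = ext ψ y ^ 2 := rfl
      simp only [this]
      ring
    rw [hsplit, integral_sPoly w ε d ρ x hρ.le hx]
    have h3 := mul_avg_sub_avg (ψ ^ 2) ⟨x, hx⟩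
    have h4 := hSe ⟨x, hx⟩
    rw [hSx] at h4
    simp only at h3 h4
    have h5 : (x / ext τ x) ^ 2 = x ^ 2 * (1 / τ ⟨x, hx⟩ ^ 2) := by
      rw [ext_of_mem τ hx]; ring
    rw [h5, h4]
    field_simp
    linear_combination (-6 * ε ^ 2 * Del a ε) * h3 - 6 * (1 - x ^ 2) * h2
  obtain ⟨r, s, φ, hb, hφ⟩ := exists_branch_of_shape (ρ := ρ) (τ := ext τ) (f := fun x => ε * ext ψ x)
    (contDiff_sPoly (α := α) (a := a) (b := b) (d₂ := d₂) w ε d).continuous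
    (contDiff_phiPoly (α := α) (a := a) (b := b) (d₂ := d₂) w ε d).continuous hρ (continuous_ext τ)
    ((continuous_ext ψ).const_mul ε) (hτ x₀) hmin hphi henergy
  refine (isPhiU_iff _ _ _ _).2 ⟨_, _, ?_, ?_, ?_, r, s, φ, hb, ?_⟩
  · rw [hτ1]; exact one_div_pos.2 (hτ 1)
  · have h3 := hSx 1
    rw [avgRightSq_one, Set.Icc.coe_one, ContinuousMap.pow_apply] at h3
    rw [hτ1, hψ1, div_pow, one_pow, hSe, h3]
    unfold sPoly
    field_simp
    linear_combination (6 : ℝ) * h2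
  · have h3 := hψx 1
    rw [avgRight_one, Set.Icc.coe_one, ContinuousMap.mul_apply, forcing_apply, Set.Icc.coe_one] at h3
    have h4 := (hτ 1).ne'
    rw [hτ1, hψ1, h3]
    unfold phiPoly
    field_simp
    ring
  · rw [hφ, hψ0]

end

section

/-! ### The family of shapes near `ε = 0` -/

variable {α ω a b d₂ d : ℝ}

/-- The shape `τ` of the unperturbed profile. -/
noncomputable def baseTau (hω : 0 < ω) (hβ : beta α ω < 1) : C(unitInterval, ℝ) :=
  ⟨fun x => (√(profS α (crest α ω) ((x : ℝ) ^ 2)))⁻¹, by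
    refine Continuous.inv₀ (by unfold profS; fun_prop) fun x => (Real.sqrt_pos.2 ?_).ne'
    exact profS_pos hω hβ (sq_nonneg _) (by nlinarith [x.2.1, x.2.2])⟩

/-- `profS` as an element of `C([0, 1])`. -/
noncomputable def baseStiff (α ρ : ℝ) : C(unitInterval, ℝ) :=
  (ρ / 2) • 1 + (α * ρ ^ 2 / 3) • ((2 : ℝ) • 1 - coordX ^ 2)

theorem baseStiff_apply (α ρ : ℝ) (x : unitInterval) :
    baseStiff α ρ x = profS α ρ ((x : ℝ) ^ 2) := by
  have h2 : coordX x = (x : ℝ) := rfl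
  simp only [baseStiff, profS, ContinuousMap.add_apply, ContinuousMap.smul_apply,
    ContinuousMap.sub_apply, ContinuousMap.pow_apply, ContinuousMap.one_apply, smul_eq_mul, h2]
  ring

theorem baseTau_pos (hω : 0 < ω) (hβ : beta α ω < 1) (x : unitInterval) :
    0 < baseTau hω hβ x :=
  inv_pos.2 (Real.sqrt_pos.2 (profS_pos hω hβ (sq_nonneg _) (by nlinarith [x.2.1, x.2.2])))

theorem baseTau_sq_mul (hω : 0 < ω) (hβ : beta α ω < 1) :
    baseTau hω hβ ^ 2 * baseStiff α (crest α ω) = 1 := by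
  ext x
  have h : 0 < profS α (crest α ω) ((x : ℝ) ^ 2) :=
    profS_pos hω hβ (sq_nonneg _) (by nlinarith [x.2.1, x.2.2])
  have h1 : baseTau hω hβ x = (√(profS α (crest α ω) ((x : ℝ) ^ 2)))⁻¹ := rfl
  rw [ContinuousMap.mul_apply, ContinuousMap.pow_apply, baseStiff_apply, h1, inv_pow,
    Real.sq_sqrt h.le, inv_mul_cancel₀ h.ne']
  rfl

theorem shapeMap_zero (w : ℝ) (e : C(unitInterval, ℝ) × ℝ) :
    shapeMap α a b d₂ ((w, 0, d), e) =
      (e.1 ^ 2 * baseStiff α e.2 - 1, w - e.2 / 2 - α * e.2 ^ 2 / 3) := by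
  simp [shapeMap, shapeStiff, baseStiff, Del]

theorem crest_energy (hω : 0 < ω) (hβ : beta α ω < 1) :
    ω - crest α ω / 2 - α * crest α ω ^ 2 / 3 = 0 := by
  have hk := kap_pos hβ
  have h2 := mul_crest hβ
  have h3 : crest α ω * (1 + kap α ω) = 4 * ω := by
    unfold crest; field_simp
  linear_combination (-1 / 3 * crest α ω) * h2 - (1 / 4 : ℝ) * h3

theorem shapeMap_base (hω : 0 < ω) (hβ : beta α ω < 1) :
    shapeMap α a b d₂ ((ω, 0, d), (baseTau hω hβ, crest α ω)) = 0 := by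
  rw [shapeMap_zero, baseTau_sq_mul, crest_energy hω hβ, sub_self]
  rfl

/-- The linearization of the shape equations in the shape, at `ε = 0`. It is triangular. -/
noncomputable def baseDeriv (hω : 0 < ω) (hβ : beta α ω < 1) :
    C(unitInterval, ℝ) × ℝ →L[ℝ] C(unitInterval, ℝ) × ℝ :=
  ((ContinuousLinearMap.mul ℝ C(unitInterval, ℝ)
      ((2 : ℝ) • baseTau hω hβ * baseStiff α (crest α ω))).comp
        (ContinuousLinearMap.fst ℝ _ _)
    + (ContinuousLinearMap.snd ℝ C(unitInterval, ℝ) ℝ).smulRight (baseTau hω hβ ^ 2 *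
        ((1 / 2 : ℝ) • 1 + (2 * α * crest α ω / 3) • ((2 : ℝ) • 1 - coordX ^ 2)))).prod
    ((-(kap α ω / 2)) • ContinuousLinearMap.snd ℝ C(unitInterval, ℝ) ℝ)

theorem baseDeriv_apply (hω : 0 < ω) (hβ : beta α ω < 1) (e : C(unitInterval, ℝ) × ℝ) :
    baseDeriv hω hβ e = ((2 : ℝ) • baseTau hω hβ * baseStiff α (crest α ω) * e.1
      + e.2 • (baseTau hω hβ ^ 2 *
        ((1 / 2 : ℝ) • 1 + (2 * α * crest α ω / 3) • ((2 : ℝ) • 1 - coordX ^ 2))),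
      -(kap α ω / 2) * e.2) := rfl

theorem hasFDerivAt_shapeMap_base (hω : 0 < ω) (hβ : beta α ω < 1) :
    HasFDerivAt (fun e => shapeMap α a b d₂ ((ω, 0, d), e)) (baseDeriv hω hβ)
      (baseTau hω hβ, crest α ω) := by
  simp only [shapeMap_zero]
  set e₀ : C(unitInterval, ℝ) × ℝ := (baseTau hω hβ, crest α ω)
  have h1 : HasFDerivAt (fun e : C(unitInterval, ℝ) × ℝ => e.1)
    (ContinuousLinearMap.fst ℝ _ _) e₀ := hasFDerivAt_fst
  have h2 : HasFDerivAt (fun e : C(unitInterval, ℝ) × ℝ => e.2)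
    (ContinuousLinearMap.snd ℝ _ _) e₀ := hasFDerivAt_snd
  have h3 := (((h2.mul_const (1 / 2)).smul_const (1 : C(unitInterval, ℝ))).add
    (((h2.pow 2).const_mul (α / 3)).smul_const ((2 : ℝ) • (1 : C(unitInterval, ℝ)) - coordX ^ 2)))
  have h4 := ((h1.pow 2).mul h3).sub_const (1 : C(unitInterval, ℝ))
  have h5 := ((h2.mul_const (1 / 2)).const_sub ω).sub ((h2.pow 2).const_mul (α / 3))
  have h6 := (h4.prodMk h5).congr_of_eventuallyEq
    (f₁ := fun e => (e.1 ^ 2 * baseStiff α e.2 - 1, ω - e.2 / 2 - α * e.2 ^ 2 / 3)) ?_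
  · refine h6.congr_fderiv ?_
    refine ContinuousLinearMap.ext fun e => ?_
    rw [baseDeriv_apply]
    have hk := mul_crest hβ
    refine Prod.ext ?_ ?_
    · ext x
      have htwo : (2 : C(unitInterval, ℝ)) x = 2 := rfl
      simp [e₀, baseStiff, htwo]
      ring
    · simp [e₀]
      linear_combination (-2 / 3 * e.2) * hk
  · refine Eventually.of_forall fun e => ?_
    refine Prod.ext ?_ ?_
    · ext x
      simp [baseStiff]
      left
      ring
    · simp; ring

theorem baseDeriv_isInvertible (hω : 0 < ω) (hβ : beta α ω < 1) :
    (baseDeriv hω hβ).IsInvertible := by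
  have hk := (kap_pos hβ).ne'
  set V : C(unitInterval, ℝ) := baseTau hω hβ ^ 2 *
        ((1 / 2 : ℝ) • 1 + (2 * α * crest α ω / 3) • ((2 : ℝ) • 1 - coordX ^ 2)) with hV
  have hone := baseTau_sq_mul hω hβ
  have hinv : ∀ f : C(unitInterval, ℝ), ((1 / 2 : ℝ) • baseTau hω hβ) *
      ((2 : ℝ) • baseTau hω hβ * baseStiff α (crest α ω) * f) = f := by
    intro f
    calc _ = (baseTau hω hβ ^ 2 * baseStiff α (crest α ω)) * f := by
          ext x; simp; ring
      _ = f := by rw [hone, one_mul]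
  set L' : C(unitInterval, ℝ) × ℝ →L[ℝ] C(unitInterval, ℝ) × ℝ :=
    ((ContinuousLinearMap.mul ℝ C(unitInterval, ℝ) ((1 / 2 : ℝ) • baseTau hω hβ)).comp
      (ContinuousLinearMap.fst ℝ _ _ +
        ((2 / kap α ω) • ContinuousLinearMap.snd ℝ C(unitInterval, ℝ) ℝ).smulRight V)).prod
    ((-(2 / kap α ω)) • ContinuousLinearMap.snd ℝ C(unitInterval, ℝ) ℝ) with hL'
  have hL'e : ∀ e, L' e = (((1 / 2 : ℝ) • baseTau hω hβ) * (e.1 + (2 / kap α ω * e.2) • V),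
    -(2 / kap α ω) * e.2) := fun e => rfl
  refine ⟨ContinuousLinearEquiv.equivOfInverse (baseDeriv hω hβ) L' (fun e => ?_) (fun e => ?_), rfl⟩
  · rw [baseDeriv_apply, hL'e, ← hV]
    refine Prod.ext ?_ ?_
    · simp only
      have : (2 / kap α ω * (-(kap α ω / 2) * e.2)) = -e.2 := by field_simp
      rw [this, neg_smul, add_neg_cancel_right, hinv]
    · simp only; field_simp
  · rw [baseDeriv_apply, hL'e, ← hV]
    refine Prod.ext ?_ ?_
    · simp only
      have : (2 : ℝ) • baseTau hω hβ * baseStiff α (crest α ω) *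
          (((1 / 2 : ℝ) • baseTau hω hβ) * (e.1 + (2 / kap α ω * e.2) • V))
          = e.1 + (2 / kap α ω * e.2) • V := by
        rw [← mul_assoc, mul_comm ((2 : ℝ) • baseTau hω hβ * baseStiff α (crest α ω)), mul_assoc, hinv]
      rw [this, add_assoc, ← add_smul]
      have : (2 / kap α ω * e.2) + -(2 / kap α ω) * e.2 = 0 := by ring
      rw [this, zero_smul, add_zero]
    · simp only; field_simp

/-- The implicit function theorem, at the unperturbed profile. It also covers `ε ≤ 0`, so that the
family is `C¹` across `ε = 0`. -/
theorem exists_shape_family (a b d₂ d : ℝ) (hω : 0 < ω) (hβ : beta α ω < 1) :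
    ∃ g : ℝ × ℝ × ℝ → C(unitInterval, ℝ) × ℝ, ContDiffAt ℝ 1 g (ω, 0, d) ∧
      g (ω, 0, d) = (baseTau hω hβ, crest α ω) ∧
      ∀ᶠ p in 𝓝 (ω, 0, d), shapeMap α a b d₂ (p, g p) = 0 := by
  set u : (ℝ × ℝ × ℝ) × (C(unitInterval, ℝ) × ℝ) := ((ω, 0, d), (baseTau hω hβ, crest α ω)) with hu
  have hc : ContDiffAt ℝ 1 (shapeMap α a b d₂) u := contDiff_shapeMap.contDiffAt
  have hinr : fderiv ℝ (shapeMap α a b d₂) u ∘L .inr ℝ (ℝ × ℝ × ℝ) (C(unitInterval, ℝ) × ℝ)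
      = baseDeriv hω hβ := by
    have h1 := (hc.differentiableAt one_ne_zero).hasFDerivAt.comp (baseTau hω hβ, crest α ω)
      (hasFDerivAt_prodMk_right (𝕜 := ℝ) (ω, (0 : ℝ), d) (baseTau hω hβ, crest α ω))
    exact h1.unique (hasFDerivAt_shapeMap_base hω hβ)
  have hI : (fderiv ℝ (shapeMap α a b d₂) u ∘L
      .inr ℝ (ℝ × ℝ × ℝ) (C(unitInterval, ℝ) × ℝ)).IsInvertible := by
    rw [hinr]; exact baseDeriv_isInvertible hω hβ
  refine ⟨hc.implicitFunction one_ne_zero hI, hc.contDiffAt_implicitFunction one_ne_zero hI,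
    hc.implicitFunction_apply_self one_ne_zero hI, ?_⟩
  have h := hc.eventually_apply_implicitFunction one_ne_zero hI
  rwa [shapeMap_base hω hβ] at h

/-- At `ε = 0` the shape equations determine the crest among the shapes with `1/2 + 2αρ/3 > 0`. -/
theorem eq_crest_of_energy {w ρ : ℝ} (hβ : beta α w < 1)
    (h : w - ρ / 2 - α * ρ ^ 2 / 3 = 0) (hρ : 0 < 1 / 2 + 2 * α * ρ / 3) : ρ = crest α w := by
  have hk := kap_pos hβ
  have h1 : 1 / 2 + 2 * α * ρ / 3 = kap α w / 2 := by
    refine (sq_eq_sq₀ hρ.le (by positivity)).1 ?_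
    rw [div_pow, kap_sq hβ]
    linear_combination (-4 / 3 * α) * h
  have h2 : 1 + kap α w ≠ 0 := by positivity
  rw [crest, eq_div_iff h2]
  linear_combination (-4 : ℝ) * h - 2 * ρ * h1

theorem eq_baseTau {w : ℝ} (hw : 0 < w) (hβ : beta α w < 1) {τ : C(unitInterval, ℝ)}
    (hτ : ∀ x, 0 < τ x) (h : τ ^ 2 * baseStiff α (crest α w) = 1) : τ = baseTau hw hβ := by
  ext x
  have hS : 0 < profS α (crest α w) ((x : ℝ) ^ 2) :=
    profS_pos hw hβ (sq_nonneg _) (by nlinarith [x.2.1, x.2.2])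
  have h1 : baseTau hw hβ x = (√(profS α (crest α w) ((x : ℝ) ^ 2)))⁻¹ := rfl
  have h2 : τ x ^ 2 * profS α (crest α w) ((x : ℝ) ^ 2) = 1 := by
    rw [← baseStiff_apply]; exact DFunLike.congr_fun h x
  rw [h1, ← Real.sqrt_inv, ← eq_inv_of_mul_eq_one_left h2, Real.sqrt_sq (hτ x).le]

/-- The Melnikov integral: `φ / ε` at the crest, at `ε = 0`. -/
theorem shapePhi_base {w : ℝ} (hw : 0 < w) (hβ : beta α w < 1) :
    shapePhi α a b d₂ (w, 0, d) (baseTau hw hβ, crest α w) 0 =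
      -(Lam 4 α w / (2 * crest α w)) * (d - d1Star α w a b d₂) := by
  have hρ := crest_pos hw hβ
  have hL4 : 0 < Lam 4 α w := Lam_pos hw hβ 1
  set S : ℝ → ℝ := fun x => √(profS α (crest α w) (x ^ 2)) with hS
  have e2 : Lam 2 α w = 2 * (crest α w ^ 1 * ∫ x in (0 : ℝ)..1, (1 - x ^ 2) ^ 0 / S x) :=
    Lam_eq hw hβ 0
  have e4 : Lam 4 α w = 2 * (crest α w ^ 2 * ∫ x in (0 : ℝ)..1, (1 - x ^ 2) ^ 1 / S x) :=
    Lam_eq hw hβ 1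
  have e6 : Lam 6 α w = 2 * (crest α w ^ 3 * ∫ x in (0 : ℝ)..1, (1 - x ^ 2) ^ 2 / S x) :=
    Lam_eq hw hβ 2
  have hSc : ∀ x ∈ Set.uIcc (0 : ℝ) 1, S x ≠ 0 := fun x hx =>
    (Real.sqrt_pos.2 (profS_pos hw hβ (sq_nonneg _) (sq_le_one_of_mem_uIcc hx))).ne'
  have hint : ∀ j : ℕ, IntervalIntegrable (fun x => (1 - x ^ 2) ^ j / S x)
      MeasureTheory.volume 0 1 := fun j => ContinuousOn.intervalIntegrable
    (ContinuousOn.div (by fun_prop) (by unfold S profS; fun_prop) hSc)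
  have hmain : shapePhi α a b d₂ (w, 0, d) (baseTau hw hβ, crest α w) 0 =
      -((b + a * w) * (∫ x in (0 : ℝ)..1, (1 - x ^ 2) ^ 0 / S x)
        + ((d - a) * crest α w * (∫ x in (0 : ℝ)..1, (1 - x ^ 2) ^ 1 / S x)
        + (d₂ - a * α) * crest α w ^ 2 * ∫ x in (0 : ℝ)..1, (1 - x ^ 2) ^ 2 / S x)) := by
    have s0 := intervalIntegral.integral_add ((hint 0).const_mul (b + a * w))
      (((hint 1).const_mul ((d - a) * crest α w)).add
        ((hint 2).const_mul ((d₂ - a * α) * crest α w ^ 2)))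
    have s1 := intervalIntegral.integral_add ((hint 1).const_mul ((d - a) * crest α w))
        ((hint 2).const_mul ((d₂ - a * α) * crest α w ^ 2))
    simp only [intervalIntegral.integral_const_mul] at s0 s1
    rw [s1] at s0
    rw [shapePhi_apply, avgRight_zero, ← s0]
    simp only [Del, Set.Icc.coe_zero]
    norm_num only
    rw [zero_mul, add_zero, inv_one, neg_one_mul, one_mul]
    congr 1
    refine intervalIntegral.integral_congr fun x hx => ?_
    have hx1 := hSc x hx
    rw [Set.uIcc_of_le zero_le_one] at hx
    have h1 : baseTau hw hβ ⟨x, hx⟩ = (S x)⁻¹ := rfl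
    simp only [ext_of_mem _ hx, ContinuousMap.mul_apply, forcing_apply, h1]
    field_simp
    ring
  have hmul := mul_Lam24 hw hβ
  have h6 := Lamd2_eq hw hβ
  have h24 : Lam 2 α w = Lam24 α w * Lam 4 α w := by rw [Lam24]; field_simp
  have h64 : Lam 6 α w = Lamd2 α w * Lam 4 α w := by rw [h6]; field_simp
  rw [← h6] at hmul
  rw [hmain]
  generalize (∫ x in (0 : ℝ)..1, (1 - x ^ 2) ^ 0 / S x) = I₀ at *
  generalize (∫ x in (0 : ℝ)..1, (1 - x ^ 2) ^ 1 / S x) = I₁ at *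
  generalize (∫ x in (0 : ℝ)..1, (1 - x ^ 2) ^ 2 / S x) = I₂ at *
  have i2 : I₀ = Lam24 α w * Lam 4 α w / (2 * crest α w) := by
    rw [← h24, e2]; field_simp
  have i4 : crest α w * I₁ = Lam 4 α w / (2 * crest α w) := by
    rw [e4]; field_simp
  have i6 : crest α w ^ 2 * I₂ = Lamd2 α w * Lam 4 α w / (2 * crest α w) := by
    rw [← h64, e6]; field_simp
  rw [mul_assoc (d - a), mul_assoc (d₂ - a * α), i2, i4, i6, d1Star]
  linear_combination (-(a * Lam 4 α w / (2 * crest α w))) * hmul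

end

section

/-! ### The value of `φ` at the crest -/

variable {α ω a b d₂ d : ℝ}

theorem eventually_forall_pos {τ : C(unitInterval, ℝ)} (hτ : ∀ x, 0 < τ x) :
    ∀ᶠ σ in 𝓝 τ, ∀ x, 0 < σ x := by
  have h : IsOpen {σ : C(unitInterval, ℝ) | Set.MapsTo σ Set.univ (Set.Ioi 0)} :=
    ContinuousMap.isOpen_setOfPred_mapsTo isCompact_univ isOpen_Ioi
  filter_upwards [h.mem_nhds (fun x _ => hτ x)] with σ hσ x using hσ (Set.mem_univ x)

/-- Near `(ω, 0, d)` the value of `φ` at the crest is `ε X(w, ε, d)` with a `C¹` function `X`, whose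
value at `ε = 0` is the Melnikov integral. -/
theorem exists_phi_family (a b d₂ d : ℝ) (hω : 0 < ω) (hβ : beta α ω < 1) :
    ∃ X : ℝ × ℝ × ℝ → ℝ, ContDiffAt ℝ 1 X (ω, 0, d) ∧
      (∀ᶠ p in 𝓝 (ω, 0, d), IsPhiU α a b p.2.2 d₂ p.2.1 0 p.1 (p.2.1 * X p)) ∧
      ∀ᶠ w in 𝓝 ω, X (w, 0, d) = -(Lam 4 α w / (2 * crest α w)) * (d - d1Star α w a b d₂) := by
  obtain ⟨g, hg, hg0, hgz⟩ := exists_shape_family a b d₂ d hω hβ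
  have hk := kap_pos hβ
  have hcont : Tendsto g (𝓝 (ω, 0, d)) (𝓝 (baseTau hω hβ, crest α ω)) :=
    hg0 ▸ hg.continuousAt.tendsto
  have hτ : ∀ᶠ p in 𝓝 (ω, 0, d), ∀ x, 0 < (g p).1 x :=
    ((continuous_fst.tendsto _).comp hcont).eventually (eventually_forall_pos (baseTau_pos hω hβ))
  have hρt : Tendsto (fun p => (g p).2) (𝓝 (ω, 0, d)) (𝓝 (crest α ω)) :=
    (continuous_snd.tendsto _).comp hcont
  have hρ : ∀ᶠ p in 𝓝 (ω, 0, d), 0 < (g p).2 := hρt.eventually (lt_mem_nhds (crest_pos hω hβ))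
  have hρ2 : ∀ᶠ p in 𝓝 (ω, 0, d), 0 < 1 / 2 + 2 * α * (g p).2 / 3 := by
    have h1 : Tendsto (fun p => 1 / 2 + 2 * α * (g p).2 / 3) (𝓝 (ω, 0, d))
        (𝓝 (1 / 2 + 2 * α * crest α ω / 3)) := ((hρt.const_mul (2 * α)).div_const 3).const_add _
    refine h1.eventually (lt_mem_nhds ?_)
    have := mul_crest hβ
    linarith
  refine ⟨fun p => shapePhi α a b d₂ p (g p) 0, ?_, ?_, ?_⟩
  · have h1 : ContDiffAt ℝ 1 (fun p => shapePhi α a b d₂ p (g p)) (ω, 0, d) :=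
      contDiff_shapePhi.contDiffAt.comp _ (contDiffAt_id.prodMk hg)
    exact (ContinuousMap.evalCLM ℝ (0 : unitInterval)).contDiff.contDiffAt.comp _ h1
  · filter_upwards [hgz, hτ, hρ] with p h1 h2 h3 using isPhiU_of_shape h3 h2 h1
  · have hline : Tendsto (fun w : ℝ => (w, (0 : ℝ), d)) (𝓝 ω) (𝓝 (ω, 0, d)) :=
      Continuous.tendsto (by fun_prop) ω
    filter_upwards [eventually_admissible hω hβ, hline.eventually hgz, hline.eventually hτ,
      hline.eventually hρ2] with w hw h1 h2 h3
    rw [shapeMap_zero, Prod.mk_eq_zero] at h1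
    have hc := eq_crest_of_energy hw.2 h1.2 h3
    have ht := eq_baseTau hw.1 hw.2 h2 (by rw [← hc]; exact sub_eq_zero.1 h1.1)
    have : g (w, 0, d) = (baseTau hw.1 hw.2, crest α w) := Prod.ext ht hc
    rw [this, shapePhi_base hw.1 hw.2]

theorem continuousAt_kap (α ω : ℝ) : ContinuousAt (kap α) ω := by
  unfold kap beta; fun_prop

theorem continuousAt_crest (hβ : beta α ω < 1) : ContinuousAt (crest α) ω :=
  ContinuousAt.div (by fun_prop) (continuousAt_const.add (continuousAt_kap α ω))
    (by have := kap_pos hβ; positivity)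

theorem continuousAt_Lam_four (hω : 0 < ω) (hβ : beta α ω < 1) : ContinuousAt (Lam 4 α) ω := by
  rcases eq_or_ne α 0 with rfl | hα
  · have h : ContinuousAt (fun w : ℝ => 16 / 3 * w * √w) ω := by fun_prop
    refine h.congr ?_
    filter_upwards [lt_mem_nhds hω] with w hw using (Lam_four_zero hw).symm
  · have hJ := (hasDerivAt_J_beta (α := α) hβ).continuousAt
    have h : ContinuousAt (fun w : ℝ => 3 / α * √w * (1 - J (beta α w))) ω :=
      ContinuousAt.mul (by fun_prop) (continuousAt_const.sub hJ)
    refine h.congr ?_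
    filter_upwards [eventually_admissible hω hβ] with w hw using (Lam_four_of_ne hα hw.1 hw.2).symm

/-- Where one factor vanishes, the product rule asks only continuity of the other one. -/
theorem hasDerivAt_mul_of_eq_zero {f g : ℝ → ℝ} {g' x : ℝ} (hf : ContinuousAt f x)
    (hg : HasDerivAt g g' x) (h0 : g x = 0) : HasDerivAt (fun y => f y * g y) (f x * g') x := by
  rw [hasDerivAt_iff_tendsto_slope] at hg ⊢
  refine ((hf.tendsto.mono_left nhdsWithin_le_nhds).mul hg).congr fun y => ?_
  simp only [slope_def_field, h0]
  ring

theorem hasDerivAt_d1Star (a b d₂ : ℝ) (hω : 0 < ω) (hβ : beta α ω < 1) :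
    HasDerivAt (fun w => d1Star α w a b d₂) (-dLam24 α ω * (b - bStar α ω a d₂)) ω := by
  have h1 := (((hasDerivAt_Lam24 hω hβ).mul_const b).const_sub (a / 4)).sub
    ((hasDerivAt_Lamd2 hω hβ).mul_const (d₂ - α * a / 3))
  refine h1.congr_deriv ?_
  have h := (dLam24_neg hω hβ).ne
  unfold bStar
  field_simp
  ring

/-- The derivative in the frequency of the value of `φ` at the crest has the sign of `b - b*`. -/
theorem exists_phiU_deriv (a b d₂ : ℝ) (hω : 0 < ω) (hβ : beta α ω < 1) (C : ℝ) :
    ∃ ε₀ > 0, ∀ ε : ℝ, 0 < ε → ε < ε₀ → ∀ d₁ : ℝ, |d₁ - d1Star α ω a b d₂| ≤ C * ε →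
      ∃ (phiU : ℝ → ℝ) (D : ℝ),
        (∀ᶠ w in 𝓝 ω, ∀ x : ℝ, IsPhiU α a b d₁ d₂ ε 0 w x ↔ x = phiU w) ∧
        HasDerivAt phiU D ω ∧ (bStar α ω a d₂ < b → 0 < D) ∧ (b < bStar α ω a d₂ → D < 0) := by
  set d := d1Star α ω a b d₂ with hd
  obtain ⟨X, hX, hphi, hX0⟩ := exists_phi_family (α := α) a b d₂ d hω hβ
  have hline : ∀ ε d₁ : ℝ, Continuous fun w : ℝ => (w, ε, d₁) := fun ε d₁ => by fun_prop
  have hlined : ∀ ε d₁ w : ℝ, HasDerivAt (fun w : ℝ => (w, ε, d₁)) ((1 : ℝ), (0 : ℝ), (0 : ℝ)) w :=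
    fun ε d₁ w => (hasDerivAt_id w).prodMk ((hasDerivAt_const w ε).prodMk (hasDerivAt_const w d₁))
  set Y : ℝ × ℝ × ℝ → ℝ := fun p => fderiv ℝ X p (1, 0, 0) with hY
  have hYc : ContinuousAt Y (ω, 0, d) :=
    ((hX.fderiv_right (m := 0) (by norm_num)).continuousAt).clm_apply continuousAt_const
  have hYd : ∀ᶠ p in 𝓝 (ω, 0, d), HasDerivAt (fun w => X (w, p.2.1, p.2.2)) (Y p) p.1 := by
    filter_upwards [hX.eventually (by simp)] with p hp
    exact (hp.differentiableAt one_ne_zero).hasFDerivAt.comp_hasDerivAt p.1 (hlined p.2.1 p.2.2 p.1)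
  have hfac : 0 < Lam 4 α ω / (2 * crest α ω) := by
    have h1 : 0 < Lam 4 α ω := Lam_pos hω hβ 1
    have h2 := crest_pos hω hβ
    positivity
  -- At `ε = 0` and `d₁ = d₁*` only the factor `d₁ - d₁*(w)` of the Melnikov integral contributes.
  have hY0 : Y (ω, 0, d) = Lam 4 α ω / (2 * crest α ω) *
      (-dLam24 α ω * (b - bStar α ω a d₂)) := by
    have h1 : HasDerivAt (fun w => X (w, 0, d)) (Y (ω, 0, d)) ω := hYd.self_of_nhds
    have h2 := hasDerivAt_mul_of_eq_zero (f := fun w => -(Lam 4 α w / (2 * crest α w)))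
      ((continuousAt_Lam_four hω hβ).div (continuousAt_const.mul (continuousAt_crest hβ))
        (mul_ne_zero two_ne_zero (crest_pos hω hβ).ne')).neg
      ((hasDerivAt_d1Star a b d₂ hω hβ).const_sub d) (by simp [hd])
    rw [h1.unique (h2.congr_of_eventuallyEq hX0)]
    ring
  have hneg := dLam24_neg hω hβ
  have hpos : ∀ᶠ p in 𝓝 (ω, 0, d), bStar α ω a d₂ < b → 0 < Y p := by
    by_cases h : bStar α ω a d₂ < b
    · have : 0 < Y (ω, 0, d) := by
        rw [hY0]
        exact mul_pos hfac (mul_pos (by linarith) (by linarith))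
      filter_upwards [hYc.eventually (lt_mem_nhds this)] with p hp _ using hp
    · exact Eventually.of_forall fun p hp => absurd hp h
  have hlt : ∀ᶠ p in 𝓝 (ω, 0, d), b < bStar α ω a d₂ → Y p < 0 := by
    by_cases h : b < bStar α ω a d₂
    · have : Y (ω, 0, d) < 0 := by
        rw [hY0]
        exact mul_neg_of_pos_of_neg hfac (mul_neg_of_pos_of_neg (by linarith) (by linarith))
      filter_upwards [hYc.eventually (gt_mem_nhds this)] with p hp _ using hp
    · exact Eventually.of_forall fun p hp => absurd hp h
  obtain ⟨δ, hδ, hball⟩ := Metric.eventually_nhds_iff.1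
    (((eventually_eventually_nhds.2 hphi).and hYd).and (hpos.and hlt))
  refine ⟨min δ (δ / (|C| + 1)), lt_min hδ (by positivity), fun ε hε hεlt d₁ hd₁ => ?_⟩
  have hdist : dist (ω, ε, d₁) (ω, 0, d) < δ := by
    have h1 : ε < δ := hεlt.trans_le (min_le_left _ _)
    have h2 : ε * (|C| + 1) < δ := (lt_div_iff₀ (by positivity)).1 (hεlt.trans_le (min_le_right _ _))
    have h3 : C * ε ≤ |C| * ε := mul_le_mul_of_nonneg_right (le_abs_self C) hε.le
    rw [Prod.dist_eq, Prod.dist_eq, dist_self, Real.dist_eq, Real.dist_eq, sub_zero, abs_of_pos hε]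
    refine max_lt hδ (max_lt h1 ?_)
    linarith
  obtain ⟨⟨h1, h2⟩, h3, h4⟩ := hball hdist
  refine ⟨fun w => ε * X (w, ε, d₁), ε * Y (ω, ε, d₁), ?_, h2.const_mul ε,
    fun h => mul_pos hε (h3 h), fun h => mul_neg_of_pos_of_neg hε (h4 h)⟩
  filter_upwards [(hline ε d₁).continuousAt.eventually h1] with w hw x
  exact ⟨fun hx => isPhiU_unique hx hw, fun hx => hx ▸ hw⟩

end

end BrightWave

theorem mainTheorem1 (α ω a b d₂ : ℝ) (hω : 0 < ω) (hβ : beta α ω < 1) :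
    (DifferentiableAt ℝ (fun w => Lam24 α w) ω ∧ DifferentiableAt ℝ (fun w => Lamd2 α w) ω ∧
      dLam24 α ω ≠ 0) ∧
    (∀ C : ℝ, ∃ ε₀ > 0, ∀ ε : ℝ, 0 < ε → ε < ε₀ →
      ∀ d₁ : ℝ, |d₁ - d1Star α ω a b d₂| ≤ C * ε →
        ∃ (phiU : ℝ → ℝ) (D : ℝ),
          (∀ᶠ w in 𝓝 ω, ∀ x : ℝ, IsPhiU α a b d₁ d₂ ε 0 w x ↔ x = phiU w) ∧
          HasDerivAt phiU D ω ∧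
          (bStar α ω a d₂ < b → 0 < D) ∧
          (b < bStar α ω a d₂ → D < 0)) ∧
    (0 ≤ beta α ω → dLamd2 α ω / dLam24 α ω < 0) :=
  ⟨⟨(hasDerivAt_Lam24 hω hβ).differentiableAt, (hasDerivAt_Lamd2 hω hβ).differentiableAt,
      (dLam24_neg hω hβ).ne⟩,
    exists_phiU_deriv a b d₂ hω hβ,
    fun h0 => div_neg_of_pos_of_neg (dLamd2_pos hω hβ h0) (dLam24_neg hω hβ)⟩
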